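/- Let $P_1,P_2\ge 0$ and $\sigma_1>0$. Consider the two-user Gaussian multiple-access channel $Y_i=X_{1,i}+X_{2,i}+\eta_i$, $i=1,\dots,N$, with $\eta_i$ i.i.d. $\mathcal N(0,\sigma_1^2)$, and with degraded message sets: independent messages $W_1,W_2$, independent of the noise, are uniform on finite nonempty sets $\mathcal W_1,\mathcal W_2$; without feedback, $X_{1,i}$ is a function of $W_1$ and $X_{2,i}$ is a function of $(W_1,W_2)$; with noiseless feedback, $X_{1,i}$ is a measurable function of $(W_1,Y^{i-1})$ and $X_{2,i}$ a measurable function of $(W_1,W_2,Y^{i-1})$, where $Y^{i-1}=(Y_1,\dots,Y_{i-1})$. The inputs satisfy the average power constraints $\frac1N\sum_{i=1}^N E[X_{j,i}^2]\le P_j$, $j=1,2$. The receiver estimates $(W_1,W_2)$ by a measurable function of $Y^N$, with error probability $P_e$ (averaged over the messages). A rate pair $(R_1,R_2)$ is achievable if for every $\epsilon>0$ and all sufficiently large $N$ there is such a code of length $N$ with $\left|\frac{\log_2|\mathcal W_j|}{N}-R_j\right|\le\epsilon$ for $j=1,2$ and $P_e\le\epsilon$. Let $\mathcal C^f_{gmac\text{-}dms}$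 and $\mathcal C_{gmac\text{-}dms}$ be the sets of achievable rate pairs (capacity regions) with and without feedback, respectively. Then feedback does not increase the capacity region: $$\mathcal C^f_{gmac\text{-}dms}=\mathcal C_{gmac\text{-}dms}=\bigcup_{0\le\rho\le1}\Big\{(R_1,R_2): R_1\ge0,\ R_2\ge0,\ R_2\le\tfrac12\log_2\Big(1+\frac{P_2(1-\rho^2)}{\sigma_1^2}\Big),\ R_1+R_2\le\tfrac12\log_2\Big(1+\frac{P_1+P_2+2\sqrt{P_1P_2}\,\rho}{\sigma_1^2}\Big)\Big\}.$$ -/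

import Mathlib

open MeasureTheory ProbabilityTheory

namespace GMACDMS

/-- A block code of length `N` for the two-user Gaussian multiple-access channel with degraded
message sets and noiseless feedback, with `M₁` common and `M₂` private messages.
At time `i`, transmitter 1 sends a (Borel) function of `w₁` and of the outputs at all earlier times,
transmitter 2 sends a function of `w₁`, `w₂` and of the outputs at all earlier times. The receiver
decodes both messages from the whole output sequence. -/
structure FeedbackCode (N M₁ M₂ : ℕ) where
  /-- channel input of transmitter 1 -/
  enc₁ : Fin M₁ → (i : Fin N) → (Fin (i : ℕ) → ℝ) → ℝ
  /-- channel input of transmitter 2 -/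
  enc₂ : Fin M₁ → Fin M₂ → (i : Fin N) → (Fin (i : ℕ) → ℝ) → ℝ
  /-- decoding function -/
  dec : (Fin N → ℝ) → Fin M₁ × Fin M₂
  measurable_enc₁ : ∀ w₁ i, Measurable (enc₁ w₁ i)
  measurable_enc₂ : ∀ w₁ w₂ i, Measurable (enc₂ w₁ w₂ i)
  measurable_dec : Measurable dec

/-- A block code without feedback: the codewords are functions of the messages only. -/
structure Code (N M₁ M₂ : ℕ) where
  /-- codeword of transmitter 1 -/
  enc₁ : Fin M₁ → Fin N → ℝ
  /-- codeword of transmitter 2 -/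
  enc₂ : Fin M₁ → Fin M₂ → Fin N → ℝ
  /-- decoding function -/
  dec : (Fin N → ℝ) → Fin M₁ × Fin M₂
  measurable_dec : Measurable dec

/-- A code without feedback, seen as a feedback code whose encoders ignore the past outputs. -/
def Code.toFeedbackCode {N M₁ M₂ : ℕ} (c : Code N M₁ M₂) : FeedbackCode N M₁ M₂ where
  enc₁ := fun w₁ i _ => c.enc₁ w₁ i
  enc₂ := fun w₁ w₂ i _ => c.enc₂ w₁ w₂ i
  dec := c.dec
  measurable_enc₁ := fun _ _ => measurable_const
  measurable_enc₂ := fun _ _ _ => measurable_const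
  measurable_dec := c.measurable_dec

/-- The law of the noise vector `η₁, …, η_N`: i.i.d. centred Gaussian with variance `σ ^ 2`. -/
noncomputable def noise (σ : ℝ) (N : ℕ) : Measure (Fin N → ℝ) :=
  Measure.pi fun _ => gaussianReal 0 (Real.toNNReal (σ ^ 2))

namespace FeedbackCode

variable {N M₁ M₂ : ℕ}

/-- The output `Y_i = X_{1,i} + X_{2,i} + η_i` at time `i` when `(w₁, w₂)` is sent and the noise
sequence is `η`; the inputs at time `i` are computed from `Y_j`, `j < i`. -/
noncomputable def output (c : FeedbackCode N M₁ M₂) (w₁ : Fin M₁) (w₂ : Fin M₂)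
    (η : Fin N → ℝ) (i : Fin N) : ℝ :=
  c.enc₁ w₁ i (fun j => output c w₁ w₂ η ⟨j, j.isLt.trans i.isLt⟩)
    + c.enc₂ w₁ w₂ i (fun j => output c w₁ w₂ η ⟨j, j.isLt.trans i.isLt⟩)
    + η i
termination_by (i : ℕ)
decreasing_by all_goals exact j.isLt

/-- The outputs before time `i`. -/
noncomputable def past (c : FeedbackCode N M₁ M₂) (w₁ : Fin M₁) (w₂ : Fin M₂)
    (η : Fin N → ℝ) (i : Fin N) : Fin (i : ℕ) → ℝ :=
  fun j => c.output w₁ w₂ η ⟨j, j.isLt.trans i.isLt⟩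

/-- The input `X_{1,i}` as a function of the messages and the noise. -/
noncomputable def input₁ (c : FeedbackCode N M₁ M₂) (w₁ : Fin M₁) (w₂ : Fin M₂)
    (η : Fin N → ℝ) (i : Fin N) : ℝ :=
  c.enc₁ w₁ i (c.past w₁ w₂ η i)

/-- The input `X_{2,i}` as a function of the messages and the noise. -/
noncomputable def input₂ (c : FeedbackCode N M₁ M₂) (w₁ : Fin M₁) (w₂ : Fin M₂)
    (η : Fin N → ℝ) (i : Fin N) : ℝ :=
  c.enc₂ w₁ w₂ i (c.past w₁ w₂ η i)

/-- The average power `(1 / N) ∑ i, E[X_{1,i} ^ 2]`, the expectation being over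
uniform messages and the noise; it may be infinite. -/
noncomputable def power₁ (c : FeedbackCode N M₁ M₂) (σ : ℝ) : ENNReal :=
  (∑ w₁, ∑ w₂, ∑ i, ∫⁻ η, ENNReal.ofReal (c.input₁ w₁ w₂ η i ^ 2) ∂(noise σ N))
    / ((M₁ : ENNReal) * (M₂ : ENNReal) * (N : ENNReal))

/-- The average power `(1 / N) ∑ i, E[X_{2,i} ^ 2]`, the expectation being over
uniform messages and the noise; it may be infinite. -/
noncomputable def power₂ (c : FeedbackCode N M₁ M₂) (σ : ℝ) : ENNReal :=
  (∑ w₁, ∑ w₂, ∑ i, ∫⁻ η, ENNReal.ofReal (c.input₂ w₁ w₂ η i ^ 2) ∂(noise σ N))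
    / ((M₁ : ENNReal) * (M₂ : ENNReal) * (N : ENNReal))

/-- The decoding error probability, averaged over all message pairs. -/
noncomputable def errorProb (c : FeedbackCode N M₁ M₂) (σ : ℝ) : ℝ :=
  (∑ w₁, ∑ w₂, (noise σ N).real {η | c.dec (c.output w₁ w₂ η) ≠ (w₁, w₂)})
    / ((M₁ : ℝ) * (M₂ : ℝ))

/-- The code meets the average power constraints `P₁`, `P₂`, has rates within `ε` of `R.1`, `R.2`,
and has average error probability at most `ε`. -/
def IsGood (c : FeedbackCode N M₁ M₂) (P₁ P₂ σ : ℝ) (R : ℝ × ℝ) (ε : ℝ) : Prop :=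
  c.power₁ σ ≤ ENNReal.ofReal P₁ ∧ c.power₂ σ ≤ ENNReal.ofReal P₂ ∧
  |Real.logb 2 M₁ / N - R.1| ≤ ε ∧ |Real.logb 2 M₂ / N - R.2| ≤ ε ∧
  c.errorProb σ ≤ ε

end FeedbackCode

/-- The capacity region with noiseless feedback: all achievable rate pairs. -/
def feedbackCapacityRegion (P₁ P₂ σ : ℝ) : Set (ℝ × ℝ) :=
  {R | ∀ ε : ℝ, 0 < ε → ∃ N₀ : ℕ, ∀ N ≥ N₀, ∃ M₁ M₂ : ℕ, 0 < M₁ ∧ 0 < M₂ ∧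
    ∃ c : FeedbackCode N M₁ M₂, c.IsGood P₁ P₂ σ R ε}

/-- The capacity region without feedback: all achievable rate pairs. -/
def capacityRegion (P₁ P₂ σ : ℝ) : Set (ℝ × ℝ) :=
  {R | ∀ ε : ℝ, 0 < ε → ∃ N₀ : ℕ, ∀ N ≥ N₀, ∃ M₁ M₂ : ℕ, 0 < M₁ ∧ 0 < M₂ ∧
    ∃ c : Code N M₁ M₂, c.toFeedbackCode.IsGood P₁ P₂ σ R ε}

/-- The explicit region: the union over the correlation coefficient `ρ ∈ [0, 1]`. -/
def explicitRegion (P₁ P₂ σ : ℝ) : Set (ℝ × ℝ) :=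
  ⋃ ρ ∈ Set.Icc (0 : ℝ) 1,
    {R : ℝ × ℝ | 0 ≤ R.1 ∧ 0 ≤ R.2 ∧
      R.2 ≤ 1 / 2 * Real.logb 2 (1 + P₂ * (1 - ρ ^ 2) / σ ^ 2) ∧
      R.1 + R.2 ≤ 1 / 2 * Real.logb 2 (1 + (P₁ + P₂ + 2 * √(P₁ * P₂) * ρ) / σ ^ 2)}

end GMACDMS

/-!
The converse bounds feedback codes and the direct part constructs codes without feedback, so the
three regions coincide.

*Converse.* Compare the output law of a code, for a fixed message pair, with the law of an auxiliary
channel `Y_i = (1 + α) X_{1,i} + noise` of noise variance `s`. Removing a causal function of the past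
outputs is a triangular shift, hence preserves Lebesgue measure (`measurePreserving_innov`); so the
likelihood ratio of the two laws is explicit, feedback or not, and the divergence is computed from
`E[(X_{2,i} - α X_{1,i}) ^ 2]` alone, because the inputs at time `i` are uncorrelated with the noise
at time `i` (`integral_logRatio`). A variational form of Fano's inequality (`log_mul_prob_le`)
bounds the log-number of messages by this divergence. The reference law depends on the common
message only, since `X_{1,i}` is a function of the common message and of the past outputs: this
gives the bound on `R₂`. For `α = -1` it depends on no message, which gives the bound on `R₁ + R₂`.
Choosing `α = E[X₁ X₂] / P₁` and `ρ = |E[X₁ X₂]| / √(P₁ P₂)`, with time- and message-averaged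
moments, yields exactly the two constraints of the explicit region (`exists_correlation`), with no
single-letterization. Compactness of `[0, 1]` removes the error terms.

*Achievability.* Random superposition coding: a cloud centre `U(w₁)` for each common message and
satellites `V(w₁, w₂)`, all standard Gaussian; transmitter 1 sends `a₁ U` and transmitter 2 sends
`a₂ U + b V`. The decoder looks for the message pair whose two information densities exceed
thresholds. A wrong word, being independent of the output, has an exponential information density of
mean one (`lintegral_exp_sum_infoDensity`), so Markov's inequality controls the union bound
(`exists_superposition_code`), while the true word passes by Chebyshev's inequality
(`exists_pi_sum_ge_le`). Words of too large power are replaced by zero and counted as errors, so that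
the power constraint holds surely (`exists_code`).
-/

namespace GMACDMS

/-! ### Gaussian noise and causal shifts -/

/-- Tonelli's theorem for a product of functions of the single coordinates. -/
lemma lintegral_pi_prod {α : Type*} [MeasurableSpace α] (μ : Measure α) [SigmaFinite μ] {N : ℕ}
    (f : Fin N → α → ENNReal) (hf : ∀ i, Measurable (f i)) :
    ∫⁻ x, ∏ i, f i (x i) ∂(Measure.pi fun _ : Fin N => μ) = ∏ i, ∫⁻ t, f i t ∂μ := by
  induction N with
  | zero => simp
  | succ N ih =>
    have hm : Measurable fun x : Fin N → α => ∏ i, f (Fin.succ i) (x i) :=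
      Finset.measurable_prod _ fun i _ => (hf _).comp (measurable_pi_apply i)
    have e := (measurePreserving_piFinSuccAbove (fun _ : Fin (N + 1) => μ) 0).symm
    rw [← e.lintegral_comp_emb (MeasurableEquiv.measurableEmbedding _)]
    simp only [MeasurableEquiv.piFinSuccAbove_symm_apply, Fin.insertNthEquiv, Equiv.coe_fn_mk,
      Fin.prod_univ_succ, Fin.insertNth_zero, Fin.cons_succ, Fin.cons_zero]
    rw [← ih (fun i => f i.succ) (fun i => hf _)]
    exact lintegral_prod_mul (hf 0).aemeasurable hm.aemeasurable

/-- The density of `N` independent centred Gaussian variables of variance `v`. -/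
noncomputable def gaussDensity (v : NNReal) {N : ℕ} (η : Fin N → ℝ) : ENNReal :=
  ∏ i, gaussianPDF 0 v (η i)

lemma measurable_gaussDensity (v : NNReal) (N : ℕ) :
    Measurable (gaussDensity v : (Fin N → ℝ) → ENNReal) :=
  Finset.measurable_prod _ fun i _ => (measurable_gaussianPDF 0 v).comp (measurable_pi_apply i)

lemma pi_gaussianReal_eq_withDensity {v : NNReal} (hv : v ≠ 0) (N : ℕ) :
    (Measure.pi fun _ : Fin N => gaussianReal 0 v) = volume.withDensity (gaussDensity v) := by
  refine Measure.pi_eq fun s hs => ?_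
  rw [withDensity_apply _ (MeasurableSet.univ_pi hs),
    ← lintegral_indicator (MeasurableSet.univ_pi hs)]
  have h : ∀ η : Fin N → ℝ, (Set.univ.pi s).indicator (gaussDensity v) η =
      ∏ i, (s i).indicator (gaussianPDF 0 v) (η i) := by
    intro η
    by_cases hη : η ∈ Set.univ.pi s
    · rw [Set.indicator_of_mem hη]
      exact Finset.prod_congr rfl fun i _ => (Set.indicator_of_mem (hη i trivial) _).symm
    · rw [Set.indicator_of_notMem hη]
      simp only [Set.mem_univ_pi, not_forall] at hη
      obtain ⟨i, hi⟩ := hη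
      exact (Finset.prod_eq_zero (Finset.mem_univ i) (Set.indicator_of_notMem hi _)).symm
  simp_rw [h]
  rw [volume_pi, lintegral_pi_prod volume _ fun i => (measurable_gaussianPDF 0 v).indicator (hs i)]
  refine Finset.prod_congr rfl fun i _ => ?_
  rw [lintegral_indicator (hs i), gaussianReal_of_var_ne_zero 0 hv, withDensity_apply _ (hs i)]

/-- The sequence `y_i - x_i(y_0, …, y_{i-1})`: the output sequence with a causal function of
itself removed. -/
def innov {N : ℕ} (x : (i : Fin N) → (Fin (i : ℕ) → ℝ) → ℝ) (y : Fin N → ℝ) (i : Fin N) : ℝ :=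
  y i - x i (fun j => y ⟨j, j.isLt.trans i.isLt⟩)

lemma measurable_innov {N : ℕ} {x : (i : Fin N) → (Fin (i : ℕ) → ℝ) → ℝ}
    (hx : ∀ i, Measurable (x i)) : Measurable (innov x) := by
  refine measurable_pi_lambda _ fun i => ?_
  exact (measurable_pi_apply i).sub
    ((hx i).comp (measurable_pi_lambda _ fun j => measurable_pi_apply _))

/-- Removing a causal function of the past is a triangular shift, so it preserves Lebesgue
measure. -/
lemma measurePreserving_innov {N : ℕ} {x : (i : Fin N) → (Fin (i : ℕ) → ℝ) → ℝ}
    (hx : ∀ i, Measurable (x i)) : MeasurePreserving (innov x) volume volume := by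
  induction N with
  | zero =>
    have : innov x = id := Subsingleton.elim _ _
    rw [this]; exact MeasurePreserving.id _
  | succ N ih =>
    let x' : (i : Fin N) → (Fin (i : ℕ) → ℝ) → ℝ := fun i => x i.castSucc
    have hx' : ∀ i, Measurable (x' i) := fun i => hx i.castSucc
    have e := volume_preserving_piFinSuccAbove (fun _ : Fin (N + 1) => ℝ) (Fin.last N)
    let g : (Fin N → ℝ) → ℝ → ℝ := fun y t => t - x (Fin.last N) y
    have hg : Measurable (Function.uncurry g) :=
      measurable_snd.sub ((hx (Fin.last N)).comp measurable_fst)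
    have hsk : MeasurePreserving (fun p : (Fin N → ℝ) × ℝ => (innov x' p.1, g p.1 p.2))
        (volume.prod volume) (volume.prod volume) :=
      (ih hx').skew_product hg
        (Filter.Eventually.of_forall fun y => (measurePreserving_sub_right volume _).map_eq)
    have h1 := Measure.measurePreserving_swap.comp (hsk.comp
      (Measure.measurePreserving_swap (μ := (volume : Measure ℝ))
        (ν := (volume : Measure (Fin N → ℝ)))))
    have h2 := e.symm.comp (h1.comp e)
    suffices hfun : innov x = _ from hfun ▸ h2
    funext y
    rw [Function.comp_apply, MeasurableEquiv.eq_symm_apply]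
    simp only [MeasurableEquiv.piFinSuccAbove, MeasurableEquiv.coe_mk, Function.comp_apply,
      Fin.insertNthEquiv]
    ext
    · simp [innov, g]
      congr 1
    · simp [innov, x']
      rfl

/-! ### Output law of a feedback code -/

instance isProbabilityMeasure_noise (σ : ℝ) (N : ℕ) : IsProbabilityMeasure (noise σ N) := by
  unfold noise; infer_instance

namespace FeedbackCode

variable {N M₁ M₂ : ℕ} (c : FeedbackCode N M₁ M₂) (w₁ : Fin M₁) (w₂ : Fin M₂)

lemma output_eq (η : Fin N → ℝ) (i : Fin N) :
    c.output w₁ w₂ η i = c.input₁ w₁ w₂ η i + c.input₂ w₁ w₂ η i + η i := by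
  rw [output]; rfl

/-- The noise is recovered from the outputs by removing the inputs, so the output map is the inverse
of a causal shift. -/
lemma output_innov (y : Fin N → ℝ) :
    c.output w₁ w₂ (innov (fun i p => c.enc₁ w₁ i p + c.enc₂ w₁ w₂ i p) y) = y := by
  suffices h : ∀ k : ℕ, ∀ hk : k < N,
      c.output w₁ w₂ (innov (fun i p => c.enc₁ w₁ i p + c.enc₂ w₁ w₂ i p) y) ⟨k, hk⟩ = y ⟨k, hk⟩ by
    funext i; exact h i i.isLt
  intro k
  induction k using Nat.strong_induction_on with
  | _ k ih =>
    intro hk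
    have hp : c.past w₁ w₂ (innov (fun i p => c.enc₁ w₁ i p + c.enc₂ w₁ w₂ i p) y) ⟨k, hk⟩ =
        fun j : Fin k => y ⟨j, j.2.trans hk⟩ := by
      funext j
      exact ih j j.isLt _
    rw [output_eq, input₁, input₂, hp]
    simp [innov]

lemma measurable_output : Measurable (c.output w₁ w₂) := by
  suffices h : ∀ k : ℕ, ∀ hk : k < N, Measurable fun η => c.output w₁ w₂ η ⟨k, hk⟩ from
    measurable_pi_lambda _ fun i => h i i.isLt
  intro k
  induction k using Nat.strong_induction_on with
  | _ k ih =>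
    intro hk
    have hp : Measurable fun η => c.past w₁ w₂ η ⟨k, hk⟩ :=
      measurable_pi_lambda _ fun j => ih j j.isLt _
    simp_rw [output_eq]
    exact (((c.measurable_enc₁ w₁ _).comp hp).add ((c.measurable_enc₂ w₁ w₂ _).comp hp)).add
      (measurable_pi_apply _)

lemma measurable_past (i : Fin N) : Measurable fun η => c.past w₁ w₂ η i :=
  measurable_pi_lambda _ fun _ => (measurable_pi_apply _).comp (c.measurable_output w₁ w₂)

lemma measurable_input₁ (i : Fin N) : Measurable fun η => c.input₁ w₁ w₂ η i :=
  (c.measurable_enc₁ w₁ _).comp (c.measurable_past w₁ w₂ i)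

lemma measurable_input₂ (i : Fin N) : Measurable fun η => c.input₂ w₁ w₂ η i :=
  (c.measurable_enc₂ w₁ w₂ _).comp (c.measurable_past w₁ w₂ i)

lemma output_congr {η η' : Fin N → ℝ} {i : Fin N} (h : ∀ j ≤ i, η j = η' j) :
    c.output w₁ w₂ η i = c.output w₁ w₂ η' i := by
  suffices H : ∀ k : ℕ, ∀ hk : k < N, (∀ j : Fin N, (j : ℕ) ≤ k → η j = η' j) →
      c.output w₁ w₂ η ⟨k, hk⟩ = c.output w₁ w₂ η' ⟨k, hk⟩ from
    H i i.isLt fun j hj => h j hj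
  intro k
  induction k using Nat.strong_induction_on with
  | _ k ih =>
    intro hk hη
    have hp : c.past w₁ w₂ η ⟨k, hk⟩ = c.past w₁ w₂ η' ⟨k, hk⟩ := by
      funext j
      exact ih j j.isLt _ fun l hl => hη l (hl.trans j.isLt.le)
    rw [output_eq, output_eq, input₁, input₂, input₁, input₂, hp, hη ⟨k, hk⟩ le_rfl]

lemma past_congr {η η' : Fin N → ℝ} {i : Fin N} (h : ∀ j < i, η j = η' j) :
    c.past w₁ w₂ η i = c.past w₁ w₂ η' i := by
  funext j
  exact c.output_congr w₁ w₂ fun l hl => h l (lt_of_le_of_lt hl (Fin.lt_def.2 j.isLt))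

end FeedbackCode

/-- The noise at time `i` is uncorrelated with every function that does not see its sign. -/
lemma integral_noise_mul_eq_zero (σ : ℝ) {N : ℕ} (i : Fin N) {f : (Fin N → ℝ) → ℝ}
    (hf : Measurable f)
    (hsymm : ∀ η, f (fun j => if j = i then -η j else η j) = f η) :
    ∫ η, η i * f η ∂(noise σ N) = 0 := by
  have hR : MeasurePreserving (fun (η : Fin N → ℝ) j => if j = i then -η j else η j)
      (noise σ N) (noise σ N) := by
    refine measurePreserving_pi (f := fun j t => if j = i then -t else t) _ _ fun j => ?_
    by_cases h : j = i
    · simp only [h, if_true]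
      exact ⟨measurable_neg, by simpa using gaussianReal_map_neg (μ := 0)⟩
    · simp only [h, if_false]
      exact MeasurePreserving.id _
  have hm : Measurable fun η : Fin N → ℝ => η i * f η := (measurable_pi_apply i).mul hf
  have h := integral_map (μ := noise σ N) hR.measurable.aemeasurable
    (f := fun η : Fin N → ℝ => η i * f η) hm.aestronglyMeasurable
  rw [hR.map_eq] at h
  simp only [hsymm, if_true, neg_mul, integral_neg] at h
  linarith

lemma memLp_noise_apply (σ : ℝ) {N : ℕ} (i : Fin N) :
    MemLp (fun η : Fin N → ℝ => η i) 2 (noise σ N) :=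
  (memLp_id_gaussianReal 2).comp_measurePreserving (measurePreserving_eval _ i)

lemma integral_sq_gaussianReal (v : NNReal) : ∫ t, t ^ 2 ∂(gaussianReal 0 v) = v := by
  have h := variance_id_gaussianReal (μ := 0) (v := v)
  rw [variance_eq_sub (memLp_id_gaussianReal 2)] at h
  simpa using h

lemma integral_noise_sq (σ : ℝ) {N : ℕ} (i : Fin N) :
    ∫ η, η i ^ 2 ∂(noise σ N) = σ ^ 2 := by
  have hR := measurePreserving_eval (fun _ : Fin N => gaussianReal 0 (Real.toNNReal (σ ^ 2))) i
  have h := integral_map (μ := Measure.pi fun _ : Fin N => gaussianReal 0 (Real.toNNReal (σ ^ 2)))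
    hR.measurable.aemeasurable (f := fun t : ℝ => t ^ 2)
    (by fun_prop : Measurable fun t : ℝ => t ^ 2).aestronglyMeasurable
  rw [hR.map_eq, integral_sq_gaussianReal, Real.coe_toNNReal _ (sq_nonneg σ)] at h
  exact h.symm

/-- The law of the outputs of the auxiliary channel `Y_i = m_i(Y_0, …, Y_{i-1}) + noise` with
Gaussian noise of variance `v`. -/
noncomputable def refLaw (v : NNReal) {N : ℕ} (m : (i : Fin N) → (Fin (i : ℕ) → ℝ) → ℝ) :
    Measure (Fin N → ℝ) :=
  volume.withDensity fun y => gaussDensity v (innov m y)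

lemma isProbabilityMeasure_refLaw {v : NNReal} (hv : v ≠ 0) {N : ℕ}
    {m : (i : Fin N) → (Fin (i : ℕ) → ℝ) → ℝ} (hm : ∀ i, Measurable (m i)) :
    IsProbabilityMeasure (refLaw v m) := by
  constructor
  rw [refLaw, withDensity_apply _ MeasurableSet.univ, Measure.restrict_univ,
    (measurePreserving_innov hm).lintegral_comp (measurable_gaussDensity v N)]
  have h := measure_univ (μ := Measure.pi fun _ : Fin N => gaussianReal 0 v)
  rwa [pi_gaussianReal_eq_withDensity hv, withDensity_apply _ MeasurableSet.univ,
    Measure.restrict_univ] at h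

/-- One-letter form of the change of measure behind `logRatio`: passing from the noise `a` of
variance `v` to the reference noise `b` of variance `s`. -/
lemma gaussianPDF_mul_exp {v s : ℝ} (hv : 0 < v) (hs : 0 < s) (a b : ℝ) :
    gaussianPDF 0 v.toNNReal a *
      ENNReal.ofReal (Real.exp (-(1 / 2 * Real.log (s / v) + b ^ 2 / (2 * s) - a ^ 2 / (2 * v)))) =
    gaussianPDF 0 s.toNNReal b := by
  rw [gaussianPDF, gaussianPDF, ← ENNReal.ofReal_mul (gaussianPDFReal_nonneg _ _ _)]
  congr 1
  rw [gaussianPDFReal, gaussianPDFReal, Real.coe_toNNReal _ hv.le, Real.coe_toNNReal _ hs.le,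
    sub_zero, sub_zero, mul_assoc, ← Real.exp_add]
  have h1 : -a ^ 2 / (2 * v) + -(1 / 2 * Real.log (s / v) + b ^ 2 / (2 * s) - a ^ 2 / (2 * v)) =
      -(1 / 2 * Real.log (s / v)) + -b ^ 2 / (2 * s) := by ring
  have h2 : Real.exp (-(1 / 2 * Real.log (s / v))) = (√(s / v))⁻¹ := by
    rw [Real.exp_neg, Real.sqrt_eq_rpow, Real.rpow_def_of_pos (div_pos hs hv), mul_comm]
  rw [h1, Real.exp_add, h2, ← mul_assoc, ← mul_inv,
    ← Real.sqrt_mul (by positivity : (0 : ℝ) ≤ 2 * Real.pi * v)]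
  rw [show 2 * Real.pi * v * (s / v) = 2 * Real.pi * s by field_simp]

namespace FeedbackCode

variable {N M₁ M₂ : ℕ} (c : FeedbackCode N M₁ M₂) (w₁ : Fin M₁) (w₂ : Fin M₂)

/-- The logarithm of the likelihood ratio between the output law of the code and the reference law
with causal mean `m` and variance `s`, as a function of the noise. -/
noncomputable def logRatio (σ s : ℝ) (m : (i : Fin N) → (Fin (i : ℕ) → ℝ) → ℝ)
    (η : Fin N → ℝ) : ℝ :=
  ∑ i, (1 / 2 * Real.log (s / σ ^ 2) + (innov m (c.output w₁ w₂ η) i) ^ 2 / (2 * s)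
    - η i ^ 2 / (2 * σ ^ 2))

lemma measurable_logRatio (σ s : ℝ) {m : (i : Fin N) → (Fin (i : ℕ) → ℝ) → ℝ}
    (hm : ∀ i, Measurable (m i)) : Measurable (c.logRatio w₁ w₂ σ s m) := by
  have h := (measurable_innov hm).comp (c.measurable_output w₁ w₂)
  refine Finset.measurable_sum _ fun i _ => ?_
  have h' : Measurable fun η => innov m (c.output w₁ w₂ η) i := (measurable_pi_apply i).comp h
  fun_prop

/-- Change of measure from the output law of the code to the reference law. -/
lemma lintegral_exp_neg_logRatio {σ s : ℝ} (hσ : 0 < σ) (hs : 0 < s)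
    {m : (i : Fin N) → (Fin (i : ℕ) → ℝ) → ℝ} (hm : ∀ i, Measurable (m i))
    {A : Set (Fin N → ℝ)} (hA : MeasurableSet A) :
    ∫⁻ η in c.output w₁ w₂ ⁻¹' A, ENNReal.ofReal (Real.exp (-c.logRatio w₁ w₂ σ s m η))
      ∂(noise σ N) = refLaw s.toNNReal m A := by
  have hv : 0 < σ ^ 2 := by positivity
  have hAm := c.measurable_output w₁ w₂ hA
  have hLm : Measurable fun η => ENNReal.ofReal (Real.exp (-c.logRatio w₁ w₂ σ s m η)) :=
    (Real.measurable_exp.comp (c.measurable_logRatio w₁ w₂ σ s hm).neg).ennreal_ofReal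
  have hdens : ∀ η, gaussDensity (σ ^ 2).toNNReal η *
      ENNReal.ofReal (Real.exp (-c.logRatio w₁ w₂ σ s m η)) =
      gaussDensity s.toNNReal (innov m (c.output w₁ w₂ η)) := by
    intro η
    rw [logRatio, ← Finset.sum_neg_distrib, Real.exp_sum,
      ENNReal.ofReal_prod_of_nonneg fun _ _ => (Real.exp_pos _).le, gaussDensity,
      ← Finset.prod_mul_distrib]
    exact Finset.prod_congr rfl fun i _ => gaussianPDF_mul_exp hv hs _ _
  have hgm : Measurable fun y : Fin N → ℝ => gaussDensity s.toNNReal (innov m y) :=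
    (measurable_gaussDensity _ N).comp (measurable_innov hm)
  rw [← lintegral_indicator hAm, noise,
    pi_gaussianReal_eq_withDensity (by simpa using hσ.ne'), lintegral_withDensity_eq_lintegral_mul _
      (measurable_gaussDensity _ N) (hLm.indicator hAm)]
  have h1 : ∀ η : Fin N → ℝ, ((gaussDensity (σ ^ 2).toNNReal : (Fin N → ℝ) → ENNReal) * (c.output w₁ w₂ ⁻¹' A).indicator fun η =>
      ENNReal.ofReal (Real.exp (-c.logRatio w₁ w₂ σ s m η)) : (Fin N → ℝ) → ENNReal) η =
      A.indicator (fun y => gaussDensity s.toNNReal (innov m y)) (c.output w₁ w₂ η) := by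
    intro η
    by_cases h : c.output w₁ w₂ η ∈ A
    · rw [Pi.mul_apply, Set.indicator_of_mem (Set.mem_preimage.2 h), Set.indicator_of_mem h, hdens]
    · rw [Pi.mul_apply, Set.indicator_of_notMem (fun h' => h (Set.mem_preimage.1 h')),
        Set.indicator_of_notMem h, mul_zero]
  simp_rw [h1]
  have hS := measurePreserving_innov (x := fun i p => c.enc₁ w₁ i p + c.enc₂ w₁ w₂ i p)
    fun i => (c.measurable_enc₁ w₁ i).add (c.measurable_enc₂ w₁ w₂ i)
  have h2 := hS.lintegral_comp
    (f := fun η => A.indicator (fun y => gaussDensity s.toNNReal (innov m y)) (c.output w₁ w₂ η))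
    ((hgm.indicator hA).comp (c.measurable_output w₁ w₂))
  simp only [c.output_innov w₁ w₂] at h2
  rw [← h2]
  rw [lintegral_indicator hA, refLaw, withDensity_apply _ hA]

lemma innov_output_eq (m : (i : Fin N) → (Fin (i : ℕ) → ℝ) → ℝ) (η : Fin N → ℝ) (i : Fin N) :
    innov m (c.output w₁ w₂ η) i =
      η i + (c.input₁ w₁ w₂ η i + c.input₂ w₁ w₂ η i - m i (c.past w₁ w₂ η i)) := by
  rw [innov, output_eq]
  change _ - m i (c.past w₁ w₂ η i) = _
  ring

/-- The expected log-likelihood ratio (a Kullback–Leibler divergence): since the inputs at time `i`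
depend on the earlier noise only, they are uncorrelated with the noise at time `i`. -/
lemma integral_logRatio {σ s : ℝ} (hσ : 0 < σ)
    {m : (i : Fin N) → (Fin (i : ℕ) → ℝ) → ℝ} (hm : ∀ i, Measurable (m i))
    (hD : ∀ i, MemLp (fun η => c.input₁ w₁ w₂ η i + c.input₂ w₁ w₂ η i -
      m i (c.past w₁ w₂ η i)) 2 (noise σ N)) :
    Integrable (c.logRatio w₁ w₂ σ s m) (noise σ N) ∧
    ∫ η, c.logRatio w₁ w₂ σ s m η ∂(noise σ N) =
      ∑ i, (1 / 2 * Real.log (s / σ ^ 2) + (σ ^ 2 + ∫ η, (c.input₁ w₁ w₂ η i + c.input₂ w₁ w₂ η i -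
        m i (c.past w₁ w₂ η i)) ^ 2 ∂(noise σ N)) / (2 * s) - 1 / 2) := by
  have hv : σ ^ 2 ≠ 0 := by positivity
  have hη := memLp_noise_apply σ (N := N)
  have hsq : ∀ i, Integrable (fun η => innov m (c.output w₁ w₂ η) i ^ 2) (noise σ N) := by
    intro i
    simp_rw [innov_output_eq]
    exact ((hη i).add (hD i)).integrable_sq
  have hval : ∀ i, ∫ η, innov m (c.output w₁ w₂ η) i ^ 2 ∂(noise σ N) =
      σ ^ 2 + ∫ η, (c.input₁ w₁ w₂ η i + c.input₂ w₁ w₂ η i -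
        m i (c.past w₁ w₂ η i)) ^ 2 ∂(noise σ N) := by
    intro i
    have hcross : ∫ η, η i * (c.input₁ w₁ w₂ η i + c.input₂ w₁ w₂ η i -
        m i (c.past w₁ w₂ η i)) ∂(noise σ N) = 0 := by
      refine integral_noise_mul_eq_zero σ i (((c.measurable_input₁ w₁ w₂ i).add
        (c.measurable_input₂ w₁ w₂ i)).sub ((hm i).comp (c.measurable_past w₁ w₂ i))) fun η => ?_
      rw [input₁, input₂, input₁, input₂, c.past_congr w₁ w₂ fun j hj => if_neg hj.ne]
    have hmul : Integrable (fun η => η i * (c.input₁ w₁ w₂ η i + c.input₂ w₁ w₂ η i -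
        m i (c.past w₁ w₂ η i))) (noise σ N) := (hη i).integrable_mul (hD i)
    simp_rw [innov_output_eq, add_sq, mul_assoc]
    rw [integral_add ((hη i).integrable_sq.fun_add (hmul.const_mul 2)) (hD i).integrable_sq,
      integral_add (hη i).integrable_sq (hmul.const_mul 2), integral_const_mul, hcross,
      integral_noise_sq]
    ring
  have hterm : ∀ i : Fin N, Integrable (fun η => 1 / 2 * Real.log (s / σ ^ 2) +
      (innov m (c.output w₁ w₂ η) i) ^ 2 / (2 * s) - η i ^ 2 / (2 * σ ^ 2)) (noise σ N) := fun i =>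
    ((integrable_const _).add ((hsq i).div_const _)).sub ((hη i).integrable_sq.div_const _)
  refine ⟨integrable_finsetSum _ fun i _ => hterm i, ?_⟩
  unfold logRatio
  rw [integral_finsetSum _ fun i _ => hterm i]
  refine Finset.sum_congr rfl fun i _ => ?_
  rw [integral_sub ((integrable_const _).fun_add ((hsq i).div_const _))
    ((hη i).integrable_sq.div_const _), integral_add (integrable_const _) ((hsq i).div_const _),
    integral_div, integral_div, hval, integral_noise_sq]
  simp
  field_simp

/-- A Fano-type inequality for one message pair: the probability of landing in `A` is controlled by
the divergence from a reference law and by the reference probability of `A`. -/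
lemma log_mul_prob_le {σ s : ℝ} (hσ : 0 < σ) (hs : 0 < s)
    {m : (i : Fin N) → (Fin (i : ℕ) → ℝ) → ℝ} (hm : ∀ i, Measurable (m i))
    (hD : ∀ i, MemLp (fun η => c.input₁ w₁ w₂ η i + c.input₂ w₁ w₂ η i -
      m i (c.past w₁ w₂ η i)) 2 (noise σ N)) {M : ℝ} (hM : 0 < M)
    {A : Set (Fin N → ℝ)} (hA : MeasurableSet A) :
    Real.log M * (noise σ N).real (c.output w₁ w₂ ⁻¹' A) - Real.log 2 + 1 ≤
      ∑ i, (1 / 2 * Real.log (s / σ ^ 2) + (σ ^ 2 + ∫ η, (c.input₁ w₁ w₂ η i + c.input₂ w₁ w₂ η i -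
        m i (c.past w₁ w₂ η i)) ^ 2 ∂(noise σ N)) / (2 * s) - 1 / 2) +
      1 / 2 * (M * (refLaw s.toNNReal m).real A + 1) := by
  obtain ⟨hLi, hL⟩ := c.integral_logRatio w₁ w₂ (s := s) hσ hm hD
  have hv : s.toNNReal ≠ 0 := by simpa using hs
  have := isProbabilityMeasure_refLaw hv hm
  set L := c.logRatio w₁ w₂ σ s m with hLdef
  set B := c.output w₁ w₂ ⁻¹' A with hB
  have hBm : MeasurableSet B := c.measurable_output w₁ w₂ hA
  have hLm : Measurable L := c.measurable_logRatio w₁ w₂ σ s hm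
  have hexpm : Measurable fun η => Real.exp (-L η) := Real.measurable_exp.comp hLm.neg
  have hexpI : Integrable (fun η => Real.exp (-L η)) (noise σ N) := by
    refine ⟨hexpm.aestronglyMeasurable, ?_⟩
    rw [hasFiniteIntegral_iff_ofReal (Filter.Eventually.of_forall fun _ => (Real.exp_pos _).le)]
    have h := c.lintegral_exp_neg_logRatio w₁ w₂ hσ hs hm MeasurableSet.univ
    rw [Set.preimage_univ, Measure.restrict_univ] at h
    rw [h]; exact measure_lt_top _ _
  have hset : ∀ A' : Set (Fin N → ℝ), MeasurableSet A' →
      ∫ η in c.output w₁ w₂ ⁻¹' A', Real.exp (-L η) ∂(noise σ N) =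
        (refLaw s.toNNReal m).real A' := by
    intro A' hA'
    rw [integral_eq_lintegral_of_nonneg_ae
      (Filter.Eventually.of_forall fun _ => (Real.exp_pos _).le) hexpm.aestronglyMeasurable,
      c.lintegral_exp_neg_logRatio w₁ w₂ hσ hs hm hA', Measure.real]
  have hIA : ∫ η, B.indicator (fun η => Real.exp (-L η)) η ∂(noise σ N) =
      (refLaw s.toNNReal m).real A := by
    rw [integral_indicator hBm, hset A hA]
  have hI1 : ∫ η, Real.exp (-L η) ∂(noise σ N) = 1 := by
    have := hset Set.univ MeasurableSet.univ
    rw [Set.preimage_univ, Measure.restrict_univ] at this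
    rw [this]; simp
  have hind : ∫ η, B.indicator (fun _ => Real.log M) η ∂(noise σ N) =
      Real.log M * (noise σ N).real B := by
    rw [integral_indicator hBm, setIntegral_const, smul_eq_mul, mul_comm]
  -- `t ≤ exp t - 1` with `t = g - L`, where `exp g` is `M / 2` on the event and `1 / 2` off it
  have hpt : ∀ η, B.indicator (fun _ => Real.log M) η + (1 - Real.log 2) ≤
      L η + 1 / 2 * (M * B.indicator (fun η => Real.exp (-L η)) η + Real.exp (-L η)) := by
    intro η
    by_cases h : η ∈ B
    · rw [Set.indicator_of_mem h, Set.indicator_of_mem h]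
      have := Real.add_one_le_exp (Real.log M - Real.log 2 + -L η)
      rw [Real.exp_add, Real.exp_sub, Real.exp_log hM, Real.exp_log two_pos] at this
      have := Real.exp_pos (-L η)
      linarith
    · rw [Set.indicator_of_notMem h, Set.indicator_of_notMem h]
      have := Real.add_one_le_exp (- Real.log 2 + -L η)
      rw [Real.exp_add, Real.exp_neg, Real.exp_log two_pos] at this
      linarith
  have hi1 : Integrable (B.indicator fun _ => Real.log M) (noise σ N) :=
    (integrable_const _).indicator hBm
  have hi2 : Integrable (B.indicator fun η => Real.exp (-L η)) (noise σ N) :=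
    hexpI.indicator hBm
  have := integral_mono (hi1.add (integrable_const (1 - Real.log 2)))
    (hLi.add (((hi2.const_mul M).add hexpI).const_mul (1 / 2))) hpt
  simp only [Pi.add_apply] at this
  rw [integral_add hi1 (integrable_const _), hind,
    integral_add hLi (((hi2.const_mul M).fun_add hexpI).const_mul (1 / 2)), hL, integral_const_mul,
    integral_add (hi2.const_mul M) hexpI, integral_const_mul, hIA, hI1] at this
  simp only [integral_const, probReal_univ, smul_eq_mul, one_mul] at this
  linarith

end FeedbackCode

/-! ### Converse -/

/-- A finite power constraint makes every input square integrable and bounds the sum of the second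
moments. -/
lemma memLp_and_sum_le_of_power_le {Ω : Type*} [MeasurableSpace Ω] {μ : Measure Ω} {N M₁ M₂ : ℕ}
    (hN : 0 < N) (hM₁ : 0 < M₁) (hM₂ : 0 < M₂) {X : Fin M₁ → Fin M₂ → Fin N → Ω → ℝ}
    (hX : ∀ w₁ w₂ i, Measurable (X w₁ w₂ i)) {P : ℝ} (hP : 0 ≤ P)
    (h : (∑ w₁, ∑ w₂, ∑ i, ∫⁻ η, ENNReal.ofReal (X w₁ w₂ i η ^ 2) ∂μ)
      / ((M₁ : ENNReal) * (M₂ : ENNReal) * (N : ENNReal)) ≤ ENNReal.ofReal P) :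
    (∀ w₁ w₂ i, MemLp (X w₁ w₂ i) 2 μ) ∧
    ∑ w₁, ∑ w₂, ∑ i, ∫ η, X w₁ w₂ i η ^ 2 ∂μ ≤ P * (M₁ * M₂ * N) := by
  have hc : ((M₁ : ENNReal) * (M₂ : ENNReal) * (N : ENNReal)) =
      ENNReal.ofReal (M₁ * M₂ * N : ℝ) := by
    rw [ENNReal.ofReal_mul (by positivity), ENNReal.ofReal_mul (by positivity)]
    simp
  have hpos : (0 : ℝ) < M₁ * M₂ * N := by positivity
  rw [hc, ENNReal.div_le_iff (by simpa using hpos) ENNReal.ofReal_ne_top,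
    ← ENNReal.ofReal_mul hP] at h
  have hfin : ∀ w₁ w₂ i, ∫⁻ η, ENNReal.ofReal (X w₁ w₂ i η ^ 2) ∂μ < ⊤ := by
    intro w₁ w₂ i
    refine lt_of_le_of_lt ?_ (lt_of_le_of_lt h ENNReal.ofReal_lt_top)
    refine le_trans ?_ (Finset.single_le_sum (fun _ _ => zero_le) (Finset.mem_univ w₁))
    refine le_trans ?_ (Finset.single_le_sum (fun _ _ => zero_le) (Finset.mem_univ w₂))
    exact Finset.single_le_sum (f := fun i => ∫⁻ η, ENNReal.ofReal (X w₁ w₂ i η ^ 2) ∂μ)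
      (fun _ _ => zero_le) (Finset.mem_univ i)
  have hint : ∀ w₁ w₂ i, Integrable (fun η => X w₁ w₂ i η ^ 2) μ := fun w₁ w₂ i =>
    ⟨((hX w₁ w₂ i).pow_const 2).aestronglyMeasurable, by
      rw [hasFiniteIntegral_iff_ofReal (Filter.Eventually.of_forall fun _ => sq_nonneg _)]
      exact hfin w₁ w₂ i⟩
  refine ⟨fun w₁ w₂ i =>
    (memLp_two_iff_integrable_sq (hX w₁ w₂ i).aestronglyMeasurable).2 (hint w₁ w₂ i), ?_⟩
  have h0 : ∀ w₁ w₂ i, 0 ≤ ∫ η, X w₁ w₂ i η ^ 2 ∂μ :=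
    fun w₁ w₂ i => integral_nonneg fun _ => sq_nonneg _
  simp_rw [fun w₁ w₂ i => (ofReal_integral_eq_lintegral_ofReal (hint w₁ w₂ i)
    (Filter.Eventually.of_forall fun _ => sq_nonneg _)).symm] at h
  simp_rw [← ENNReal.ofReal_sum_of_nonneg fun i _ => h0 _ _ i] at h
  simp_rw [← ENNReal.ofReal_sum_of_nonneg fun w₂ _ => Finset.sum_nonneg fun i _ => h0 _ w₂ i] at h
  rw [← ENNReal.ofReal_sum_of_nonneg fun w₁ _ => Finset.sum_nonneg fun w₂ _ =>
    Finset.sum_nonneg fun i _ => h0 w₁ w₂ i] at h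
  exact (ENNReal.ofReal_le_ofReal_iff (by positivity)).1 h

namespace FeedbackCode

variable {N M₁ M₂ : ℕ} (c : FeedbackCode N M₁ M₂)

/-- The Fano-type inequality averaged over the messages, with reference mean `(1 + α) X₁`.
For `α = -1` the reference law does not depend on the common message. -/
lemma log_mul_sum_prob_le {σ : ℝ} (hσ : 0 < σ)
    (h₁ : ∀ w₁ w₂ i, MemLp (fun η => c.input₁ w₁ w₂ η i) 2 (noise σ N))
    (h₂ : ∀ w₁ w₂ i, MemLp (fun η => c.input₂ w₁ w₂ η i) 2 (noise σ N))
    (α : ℝ) {K : ℝ} (hK : 0 ≤ K)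
    (hsum : ∑ w₁, ∑ w₂, ∑ i, ∫ η, (c.input₂ w₁ w₂ η i - α * c.input₁ w₁ w₂ η i) ^ 2 ∂(noise σ N) ≤
      K * (M₁ * M₂ * N)) {M : ℝ} (hM : 0 < M)
    {A : Fin M₁ → Fin M₂ → Set (Fin N → ℝ)} (hA : ∀ w₁ w₂, MeasurableSet (A w₁ w₂))
    (hQ : ∀ Q : Fin M₁ → Measure (Fin N → ℝ), (∀ w, IsProbabilityMeasure (Q w)) →
      (α = -1 → ∀ w w', Q w = Q w') → ∑ w₁, ∑ w₂, M * (Q w₁).real (A w₁ w₂) ≤ M₁ * M₂) :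
    Real.log M * ∑ w₁, ∑ w₂, (noise σ N).real (c.output w₁ w₂ ⁻¹' A w₁ w₂) ≤
      M₁ * M₂ * (N / 2 * Real.log (1 + K / σ ^ 2) + Real.log 2) := by
  set s := σ ^ 2 + K with hs
  have hs0 : 0 < s := by positivity
  let m : Fin M₁ → (i : Fin N) → (Fin (i : ℕ) → ℝ) → ℝ := fun w₁ i p => (1 + α) * c.enc₁ w₁ i p
  have hm : ∀ w₁ i, Measurable (m w₁ i) := fun w₁ i => (c.measurable_enc₁ w₁ i).const_mul _
  have hDeq : ∀ w₁ w₂ i, (fun η => c.input₁ w₁ w₂ η i + c.input₂ w₁ w₂ η i -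
      m w₁ i (c.past w₁ w₂ η i)) = fun η => c.input₂ w₁ w₂ η i - α * c.input₁ w₁ w₂ η i := by
    intro w₁ w₂ i
    funext η
    change _ - (1 + α) * c.input₁ w₁ w₂ η i = _
    ring
  have hD : ∀ w₁ w₂ i, MemLp (fun η => c.input₁ w₁ w₂ η i + c.input₂ w₁ w₂ η i -
      m w₁ i (c.past w₁ w₂ η i)) 2 (noise σ N) := fun w₁ w₂ i => by
    rw [hDeq]; exact (h₂ w₁ w₂ i).sub ((h₁ w₁ w₂ i).const_mul α)
  have hQ' := hQ (fun w₁ => refLaw s.toNNReal (m w₁))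
    (fun w₁ => isProbabilityMeasure_refLaw (by simpa using hs0) (hm w₁))
    (fun h w w' => by simp [m, h])
  have hone := Finset.sum_le_sum fun w₁ (_ : w₁ ∈ Finset.univ) => Finset.sum_le_sum
    fun w₂ (_ : w₂ ∈ Finset.univ) =>
      c.log_mul_prob_le w₁ w₂ hσ hs0 (hm w₁) (hD w₁ w₂) hM (hA w₁ w₂)
  have hDi : ∀ w₁ w₂ i, ∫ η, (c.input₁ w₁ w₂ η i + c.input₂ w₁ w₂ η i -
      m w₁ i (c.past w₁ w₂ η i)) ^ 2 ∂(noise σ N) =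
      ∫ η, (c.input₂ w₁ w₂ η i - α * c.input₁ w₁ w₂ η i) ^ 2 ∂(noise σ N) := by
    intro w₁ w₂ i
    refine integral_congr_ae (Filter.Eventually.of_forall fun η => ?_)
    exact congrArg (· ^ 2) (congrFun (hDeq w₁ w₂ i) η)
  simp_rw [hDi] at hone
  have hr : s / σ ^ 2 = 1 + K / σ ^ 2 := by rw [hs]; field_simp
  simp only [Finset.sum_add_distrib, Finset.sum_sub_distrib, ← Finset.mul_sum, ← Finset.sum_div,
    Finset.sum_const, Finset.card_univ, Fintype.card_fin, nsmul_eq_mul, mul_one, hr] at hone hQ'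
  have hfrac : (N * (M₂ * (M₁ * σ ^ 2)) + ∑ w₁, ∑ w₂, ∑ i,
      ∫ η, (c.input₂ w₁ w₂ η i - α * c.input₁ w₁ w₂ η i) ^ 2 ∂(noise σ N)) / (2 * s) ≤
      M₁ * M₂ * N / 2 := by
    rw [div_le_iff₀ (by positivity), hs]
    linarith
  linarith

/-- A code with small error probability nearly meets the rate constraints for the correlation
coefficient `ρ` of its own inputs. -/
lemma exists_correlation {σ P₁ P₂ : ℝ} (hσ : 0 < σ) (hP₁ : 0 ≤ P₁) (hP₂ : 0 ≤ P₂)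
    (hN : 0 < N) (hM₁ : 0 < M₁) (hM₂ : 0 < M₂)
    (hp₁ : c.power₁ σ ≤ ENNReal.ofReal P₁) (hp₂ : c.power₂ σ ≤ ENNReal.ofReal P₂) :
    ∃ ρ ∈ Set.Icc (0 : ℝ) 1,
      (1 - c.errorProb σ) * Real.log M₂ ≤
        N / 2 * Real.log (1 + P₂ * (1 - ρ ^ 2) / σ ^ 2) + Real.log 2 ∧
      (1 - c.errorProb σ) * (Real.log M₁ + Real.log M₂) ≤
        N / 2 * Real.log (1 + (P₁ + P₂ + 2 * √(P₁ * P₂) * ρ) / σ ^ 2) + Real.log 2 := by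
  obtain ⟨h₁, hs₁⟩ := memLp_and_sum_le_of_power_le hN hM₁ hM₂
    (fun w₁ w₂ i => c.measurable_input₁ w₁ w₂ i) hP₁ hp₁
  obtain ⟨h₂, hs₂⟩ := memLp_and_sum_le_of_power_le hN hM₁ hM₂
    (fun w₁ w₂ i => c.measurable_input₂ w₁ w₂ i) hP₂ hp₂
  have hT : (0 : ℝ) < M₁ * M₂ * N := by positivity
  have hMM : (0 : ℝ) < M₁ * M₂ := by positivity
  set T : ℝ := M₁ * M₂ * N with hTdef
  set a := (∑ w₁, ∑ w₂, ∑ i, ∫ η, c.input₁ w₁ w₂ η i ^ 2 ∂(noise σ N)) / T with ha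
  set b := (∑ w₁, ∑ w₂, ∑ i, ∫ η, c.input₂ w₁ w₂ η i ^ 2 ∂(noise σ N)) / T with hb
  set r := (∑ w₁, ∑ w₂, ∑ i, ∫ η, c.input₁ w₁ w₂ η i * c.input₂ w₁ w₂ η i ∂(noise σ N)) / T with hr
  have haP : a ≤ P₁ := by rwa [ha, div_le_iff₀ hT]
  have hbP : b ≤ P₂ := by rwa [hb, div_le_iff₀ hT]
  have hquad : ∀ α : ℝ, ∑ w₁, ∑ w₂, ∑ i,
      ∫ η, (c.input₂ w₁ w₂ η i - α * c.input₁ w₁ w₂ η i) ^ 2 ∂(noise σ N) =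
      (b - 2 * α * r + α ^ 2 * a) * T := by
    intro α
    have h : ∀ w₁ w₂ i, ∫ η, (c.input₂ w₁ w₂ η i - α * c.input₁ w₁ w₂ η i) ^ 2 ∂(noise σ N) =
        ∫ η, c.input₂ w₁ w₂ η i ^ 2 ∂(noise σ N) -
        2 * α * ∫ η, c.input₁ w₁ w₂ η i * c.input₂ w₁ w₂ η i ∂(noise σ N) +
        α ^ 2 * ∫ η, c.input₁ w₁ w₂ η i ^ 2 ∂(noise σ N) := by
      intro w₁ w₂ i
      have i1 := (h₁ w₁ w₂ i).integrable_sq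
      have i2 := (h₂ w₁ w₂ i).integrable_sq
      have i3 : Integrable (fun η => c.input₁ w₁ w₂ η i * c.input₂ w₁ w₂ η i) (noise σ N) :=
        (h₁ w₁ w₂ i).integrable_mul (h₂ w₁ w₂ i)
      rw [← integral_const_mul, ← integral_const_mul, ← integral_sub i2 (i3.const_mul _),
        ← integral_add
          (f := fun η => c.input₂ w₁ w₂ η i ^ 2 - 2 * α * (c.input₁ w₁ w₂ η i * c.input₂ w₁ w₂ η i))
          (i2.sub (i3.const_mul _)) (i1.const_mul _)]
      congr 1
      funext η
      ring
    simp_rw [h, Finset.sum_add_distrib, Finset.sum_sub_distrib, ← Finset.mul_sum]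
    rw [ha, hb, hr]
    field_simp
  have hnn : ∀ α : ℝ, 0 ≤ b - 2 * α * r + α ^ 2 * a := by
    intro α
    have : 0 ≤ (b - 2 * α * r + α ^ 2 * a) * T := by
      rw [← hquad]
      exact Finset.sum_nonneg fun _ _ => Finset.sum_nonneg fun _ _ => Finset.sum_nonneg fun _ _ =>
        integral_nonneg fun _ => sq_nonneg _
    exact nonneg_of_mul_nonneg_left this hT
  have ha0 : 0 ≤ a := by
    rw [ha]
    exact div_nonneg (Finset.sum_nonneg fun _ _ => Finset.sum_nonneg fun _ _ =>
      Finset.sum_nonneg fun _ _ => integral_nonneg fun _ => sq_nonneg _) hT.le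
  have hb0 : 0 ≤ b := by simpa using hnn 0
  have hcs : r ^ 2 ≤ a * b := by
    have := discrim_le_zero (a := a) (b := -(2 * r)) (c := b) fun x => by
      have := hnn x; linarith
    rw [discrim] at this
    linarith
  have hcsP : r ^ 2 ≤ P₁ * P₂ := hcs.trans (mul_le_mul haP hbP hb0 hP₁)
  have hrabs : |r| ≤ √(P₁ * P₂) := Real.abs_le_sqrt hcsP
  set ρ := |r| / √(P₁ * P₂) with hρ
  have hρ0 : 0 ≤ ρ := by positivity
  have hρ1 : ρ ≤ 1 := div_le_one_of_le₀ hrabs (Real.sqrt_nonneg _)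
  have hρ2 : √(P₁ * P₂) * ρ = |r| := by
    rcases eq_or_lt_of_le (Real.sqrt_nonneg (P₁ * P₂)) with h | h
    · rw [← h] at hrabs ⊢
      rw [zero_mul]; exact le_antisymm (abs_nonneg r) hrabs
    · rw [hρ]; field_simp
  -- the linear estimation coefficient `α = E[X₁ X₂] / P₁` realizes the factor `1 - ρ ^ 2`
  have hres : b - 2 * (r / P₁) * r + (r / P₁) ^ 2 * a ≤ P₂ * (1 - ρ ^ 2) := by
    rcases eq_or_lt_of_le (mul_nonneg hP₁ hP₂) with h | h
    · have hr0 : r = 0 := by nlinarith [sq_nonneg r]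
      have hρ00 : ρ = 0 := by rw [hρ, hr0]; simp
      rw [hr0, hρ00]; simpa using hbP
    · have hP₁' : 0 < P₁ := lt_of_le_of_ne hP₁ fun h' => by rw [← h'] at h; simp at h
      have hP₂' : 0 < P₂ := lt_of_le_of_ne hP₂ fun h' => by rw [← h'] at h; simp at h
      have e1 : ρ ^ 2 = r ^ 2 / (P₁ * P₂) := by
        rw [hρ, div_pow, sq_abs, Real.sq_sqrt h.le]
      have e2 : P₂ * (1 - ρ ^ 2) = P₂ - r ^ 2 / P₁ := by rw [e1]; field_simp
      have e3 : (r / P₁) ^ 2 * a ≤ (r / P₁) ^ 2 * P₁ :=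
        mul_le_mul_of_nonneg_left haP (sq_nonneg _)
      have e4 : (r / P₁) ^ 2 * P₁ = r ^ 2 / P₁ := by field_simp
      have e5 : 2 * (r / P₁) * r = 2 * (r ^ 2 / P₁) := by ring
      linarith
  have hok : ∑ w₁, ∑ w₂, (noise σ N).real (c.output w₁ w₂ ⁻¹' (c.dec ⁻¹' {(w₁, w₂)})) =
      M₁ * M₂ * (1 - c.errorProb σ) := by
    have h : ∀ w₁ w₂, (noise σ N).real (c.output w₁ w₂ ⁻¹' (c.dec ⁻¹' {(w₁, w₂)})) =
        1 - (noise σ N).real {η | c.dec (c.output w₁ w₂ η) ≠ (w₁, w₂)} := by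
      intro w₁ w₂
      have := probReal_compl_eq_one_sub (μ := noise σ N)
        (c.measurable_output w₁ w₂ (c.measurable_dec (measurableSet_singleton (w₁, w₂))))
      have hset : {η | c.dec (c.output w₁ w₂ η) ≠ (w₁, w₂)} =
          (c.output w₁ w₂ ⁻¹' (c.dec ⁻¹' {(w₁, w₂)}))ᶜ := by ext; simp
      rw [hset, this]; ring
    simp_rw [h, Finset.sum_sub_distrib]
    rw [errorProb, mul_sub, mul_div_cancel₀ _ hMM.ne']
    simp
  have hlog₁ : 0 ≤ Real.log M₁ := Real.log_natCast_nonneg _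
  have hlog₂ : 0 ≤ Real.log M₂ := Real.log_natCast_nonneg _
  refine ⟨ρ, ⟨hρ0, hρ1⟩, ?_, ?_⟩
  · have hK : 0 ≤ P₂ * (1 - ρ ^ 2) := mul_nonneg hP₂ (by nlinarith)
    have h := c.log_mul_sum_prob_le hσ h₁ h₂ (r / P₁) hK
      ((hquad _).le.trans (mul_le_mul_of_nonneg_right hres hT.le)) (M := M₂) (by positivity)
      (A := fun _ w₂ => c.dec ⁻¹' (Prod.snd ⁻¹' {w₂}))
      (fun w₁ w₂ => c.measurable_dec (measurable_snd (measurableSet_singleton w₂))) (by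
        intro Q hQp _
        have : ∀ w₁, ∑ w₂, (Q w₁).real (c.dec ⁻¹' (Prod.snd ⁻¹' {w₂})) = 1 := by
          intro w₁
          have := hQp w₁
          have h := sum_measureReal_preimage_singleton (μ := Q w₁) (Finset.univ : Finset (Fin M₂))
            (f := fun y => (c.dec y).2)
            (fun w₂ _ => (measurable_snd.comp c.measurable_dec) (measurableSet_singleton w₂))
          refine h.trans ?_
          simp
        simp_rw [← Finset.mul_sum, this]
        simp [mul_comm])
    have hle : ∑ w₁, ∑ w₂, (noise σ N).real (c.output w₁ w₂ ⁻¹' (c.dec ⁻¹' {(w₁, w₂)})) ≤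
        ∑ w₁, ∑ w₂, (noise σ N).real (c.output w₁ w₂ ⁻¹' (c.dec ⁻¹' (Prod.snd ⁻¹' {w₂}))) := by
      refine Finset.sum_le_sum fun w₁ _ => Finset.sum_le_sum fun w₂ _ => measureReal_mono ?_
      intro η hη
      simp only [Set.mem_preimage, Set.mem_singleton_iff] at hη ⊢
      rw [hη]
    rw [hok] at hle
    have := (mul_le_mul_of_nonneg_left hle hlog₂).trans h
    refine le_of_mul_le_mul_left ?_ hMM
    linarith
  · have hK : 0 ≤ P₁ + P₂ + 2 * √(P₁ * P₂) * ρ := by positivity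
    have hres' : b - 2 * (-1) * r + (-1) ^ 2 * a ≤ P₁ + P₂ + 2 * √(P₁ * P₂) * ρ := by
      rw [mul_assoc 2 √(P₁ * P₂), hρ2]
      linarith [le_abs_self r]
    have h := c.log_mul_sum_prob_le hσ h₁ h₂ (-1) hK
      ((hquad _).le.trans (mul_le_mul_of_nonneg_right hres' hT.le)) (M := M₁ * M₂) hMM
      (A := fun w₁ w₂ => c.dec ⁻¹' {(w₁, w₂)})
      (fun w₁ w₂ => c.measurable_dec (measurableSet_singleton _)) (by
        intro Q hQp hQ
        have := hQp ⟨0, hM₁⟩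
        simp_rw [fun w => hQ rfl w ⟨0, hM₁⟩, ← Finset.mul_sum]
        have h := sum_measureReal_preimage_singleton (μ := Q ⟨0, hM₁⟩)
          (Finset.univ : Finset (Fin M₁ × Fin M₂)) (f := c.dec)
          (fun w₂ _ => c.measurable_dec (measurableSet_singleton _))
        rw [Fintype.sum_prod_type] at h
        rw [h]
        simp)
    rw [hok, Real.log_mul (by positivity) (by positivity)] at h
    refine le_of_mul_le_mul_left ?_ hMM
    linarith

end FeedbackCode

open Filter Topology in
/-- The converse: feedback does not help beyond the explicit region. -/
lemma feedbackCapacityRegion_subset {P₁ P₂ σ : ℝ} (hP₁ : 0 ≤ P₁) (hP₂ : 0 ≤ P₂) (hσ : 0 < σ) :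
    feedbackCapacityRegion P₁ P₂ σ ⊆ explicitRegion P₁ P₂ σ := by
  intro R hR
  let e : ℕ → ℝ := fun n => 1 / ((n : ℝ) + 1)
  have he0 : ∀ n, 0 < e n := fun n => Nat.one_div_pos_of_nat
  have hlim : Tendsto e atTop (𝓝 0) := tendsto_one_div_add_atTop_nhds_zero_nat
  have hlog2 : 0 < Real.log 2 := Real.log_pos one_lt_two
  have key : ∀ n : ℕ, ∃ ρ ∈ Set.Icc (0 : ℝ) 1, -e n ≤ R.1 ∧ -e n ≤ R.2 ∧
      (1 - e n) * (R.2 - e n) ≤ 1 / 2 * Real.logb 2 (1 + P₂ * (1 - ρ ^ 2) / σ ^ 2) + e n ∧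
      (1 - e n) * (R.1 + R.2 - 2 * e n) ≤
        1 / 2 * Real.logb 2 (1 + (P₁ + P₂ + 2 * √(P₁ * P₂) * ρ) / σ ^ 2) + e n := by
    intro n
    obtain ⟨N₀, hN₀⟩ := hR (e n) (he0 n)
    obtain ⟨N, hNN₀, hNn⟩ : ∃ N, N₀ ≤ N ∧ n + 1 ≤ N :=
      ⟨max N₀ (n + 1), le_max_left _ _, le_max_right _ _⟩
    obtain ⟨M₁, M₂, hM₁, hM₂, c, hp₁, hp₂, hr₁, hr₂, herr⟩ := hN₀ N hNN₀
    have hN : 0 < N := by omega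
    have hNe : 1 / (N : ℝ) ≤ e n :=
      one_div_le_one_div_of_le (by positivity) (by exact_mod_cast hNn)
    obtain ⟨ρ, hρ, hb₂, hb₁₂⟩ := c.exists_correlation hσ hP₁ hP₂ hN hM₁ hM₂ hp₁ hp₂
    have hl₁ : 0 ≤ Real.logb 2 M₁ / N :=
      div_nonneg (Real.logb_nonneg one_lt_two (by exact_mod_cast hM₁)) (by positivity)
    have hl₂ : 0 ≤ Real.logb 2 M₂ / N :=
      div_nonneg (Real.logb_nonneg one_lt_two (by exact_mod_cast hM₂)) (by positivity)
    rw [abs_le] at hr₁ hr₂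
    have he1 : e n ≤ 1 := by
      simp only [e]
      rw [div_le_one (by positivity)]
      linarith [Nat.cast_nonneg (α := ℝ) n]
    -- passing to binary logarithms per channel use
    have conv : ∀ x y : ℝ, 0 ≤ x → (1 - c.errorProb σ) * x ≤ N / 2 * y + Real.log 2 →
        (1 - e n) * (x / Real.log 2 / N) ≤ 1 / 2 * (y / Real.log 2) + e n := by
      intro x y hx h
      have h1 : (1 - e n) * x ≤ (1 - c.errorProb σ) * x :=
        mul_le_mul_of_nonneg_right (by linarith) hx
      have hNpos : (0 : ℝ) < N := by positivity
      calc (1 - e n) * (x / Real.log 2 / N) = ((1 - e n) * x) / (Real.log 2 * N) := by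
            field_simp
        _ ≤ (N / 2 * y + Real.log 2) / (Real.log 2 * N) := by gcongr; linarith
        _ = 1 / 2 * (y / Real.log 2) + 1 / N := by field_simp
        _ ≤ _ := by linarith
    refine ⟨ρ, hρ, by linarith, by linarith, ?_, ?_⟩
    · have := conv _ _ (Real.log_natCast_nonneg M₂) hb₂
      have h2 : (1 - e n) * (R.2 - e n) ≤ (1 - e n) * (Real.logb 2 M₂ / N) :=
        mul_le_mul_of_nonneg_left (by linarith) (by linarith)
      exact h2.trans this
    · have := conv _ _ (add_nonneg (Real.log_natCast_nonneg M₁) (Real.log_natCast_nonneg M₂)) hb₁₂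
      rw [add_div, add_div] at this
      have h2 : (1 - e n) * (R.1 + R.2 - 2 * e n) ≤
          (1 - e n) * (Real.logb 2 M₁ / N + Real.logb 2 M₂ / N) :=
        mul_le_mul_of_nonneg_left (by linarith) (by linarith)
      exact h2.trans this
  choose ρ hρ hR₁ hR₂ hb₂ hb₁₂ using key
  obtain ⟨ρ', hρ', φ, hφ, hconv⟩ := isCompact_Icc.tendsto_subseq hρ
  have hlimφ : Tendsto (e ∘ φ) atTop (𝓝 0) := hlim.comp hφ.tendsto_atTop
  have hpos₂ : (1 + P₂ * (1 - ρ' ^ 2) / σ ^ 2) ≠ 0 := by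
    have : 0 ≤ 1 - ρ' ^ 2 := by nlinarith [hρ'.1, hρ'.2]
    positivity
  have hpos₁₂ : (1 + (P₁ + P₂ + 2 * √(P₁ * P₂) * ρ') / σ ^ 2) ≠ 0 := by
    have := hρ'.1
    positivity
  have hlog : ∀ (f : ℝ → ℝ), Continuous f → f ρ' ≠ 0 →
      Tendsto (fun n => 1 / 2 * Real.logb 2 (f ((ρ ∘ φ) n)) + (e ∘ φ) n) atTop
        (𝓝 (1 / 2 * Real.logb 2 (f ρ') + 0)) := by
    intro f hf h0
    have hc : ContinuousAt (fun x => Real.log (f x)) ρ' := hf.continuousAt.log h0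
    exact (((hc.tendsto.comp hconv).div_const (Real.log 2)).const_mul (1 / 2)).add hlimφ
  refine Set.mem_iUnion₂.2 ⟨ρ', hρ', ?_, ?_, ?_, ?_⟩
  · exact le_of_tendsto' (f := fun n => -e n) (by simpa using hlim.neg) hR₁
  · exact le_of_tendsto' (f := fun n => -e n) (by simpa using hlim.neg) hR₂
  · have h1 : Tendsto (fun n => (1 - (e ∘ φ) n) * (R.2 - (e ∘ φ) n)) atTop
        (𝓝 ((1 - 0) * (R.2 - 0))) := (hlimφ.const_sub 1).mul (hlimφ.const_sub _)
    have h2 := hlog (fun x => 1 + P₂ * (1 - x ^ 2) / σ ^ 2) (by fun_prop) hpos₂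
    simpa using le_of_tendsto_of_tendsto' h1 h2 fun n => hb₂ (φ n)
  · have h1 : Tendsto (fun n => (1 - (e ∘ φ) n) * (R.1 + R.2 - 2 * (e ∘ φ) n)) atTop
        (𝓝 ((1 - 0) * (R.1 + R.2 - 2 * 0))) :=
      (hlimφ.const_sub 1).mul ((hlimφ.const_mul 2).const_sub _)
    have h2 := hlog (fun x => 1 + (P₁ + P₂ + 2 * √(P₁ * P₂) * x) / σ ^ 2) (by fun_prop) hpos₁₂
    simpa using le_of_tendsto_of_tendsto' h1 h2 fun n => hb₁₂ (φ n)

/-! ### Random superposition coding -/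

section RandomCoding

lemma measurePreserving_eval_pair {ι α : Type*} [Fintype ι] [MeasurableSpace α] (μ : Measure α)
    [IsProbabilityMeasure μ] {i j : ι} (h : i ≠ j) :
    MeasurePreserving (fun x : ι → α => (x i, x j)) (Measure.pi fun _ => μ) (μ.prod μ) := by
  refine ⟨by fun_prop, ?_⟩
  have hind : IndepFun (fun x : ι → α => x i) (fun x : ι → α => x j) (Measure.pi fun _ => μ) :=
    (iIndepFun_pi (μ := fun _ : ι => μ) (X := fun _ a => a) fun _ => aemeasurable_id).indepFun h
  rw [(indepFun_iff_map_prod_eq_prod_map_map (measurable_pi_apply i).aemeasurable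
    (measurable_pi_apply j).aemeasurable).1 hind]
  exact congrArg₂ _ (measurePreserving_eval (fun _ : ι => μ) i).map_eq
    (measurePreserving_eval (fun _ : ι => μ) j).map_eq

/-- If an independent competitor `b` passes a test with probability at most `q` whatever the
context `a` and the noise `e`, then so it does on average. -/
lemma lintegral_measure_le_of_indep {α β E : Type*} [MeasurableSpace α] [MeasurableSpace β]
    [MeasurableSpace E] (μa : Measure α) (μb : Measure β) (μe : Measure E)
    [IsProbabilityMeasure μa] [IsProbabilityMeasure μb] [IsProbabilityMeasure μe]
    {S : Set ((α × β) × E)} (hS : MeasurableSet S) {q : ENNReal}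
    (hq : ∀ a e, μb {b | ((a, b), e) ∈ S} ≤ q) :
    ∫⁻ p, μe {e | (p, e) ∈ S} ∂(μa.prod μb) ≤ q := by
  have hm : Measurable fun p => μe {e | (p, e) ∈ S} := measurable_measure_prodMk_left hS
  rw [lintegral_prod _ hm.aemeasurable]
  have h : ∀ a, ∫⁻ b, μe {e | ((a, b), e) ∈ S} ∂μb ≤ q := by
    intro a
    have hSa : MeasurableSet {p : β × E | ((a, p.1), p.2) ∈ S} :=
      hS.preimage (by fun_prop : Measurable fun p : β × E => ((a, p.1), p.2))
    have h1 := Measure.prod_apply (μ := μb) (ν := μe) hSa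
    have h2 := Measure.prod_apply_symm (μ := μb) (ν := μe) hSa
    calc ∫⁻ b, μe {e | ((a, b), e) ∈ S} ∂μb = ∫⁻ e, μb {b | ((a, b), e) ∈ S} ∂μe :=
          h1.symm.trans h2
      _ ≤ ∫⁻ _, q ∂μe := lintegral_mono fun e => hq a e
      _ = q := by simp
  calc _ ≤ ∫⁻ _, q ∂μa := lintegral_mono h
    _ = q := by simp

/-- A decoder that picks some index passing a measurable test is measurable. -/
lemma exists_measurable_decoder {W Y : Type*} [Fintype W] [Nonempty W] [MeasurableSpace W]
    [DiscreteMeasurableSpace W] [MeasurableSpace Y] {G : W → Set Y}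
    (hG : ∀ w, MeasurableSet (G w)) :
    ∃ dec : Y → W, Measurable dec ∧ ∀ y w, y ∈ G w → (∀ w', w' ≠ w → y ∉ G w') → dec y = w := by
  classical
  let pick : (W → Bool) → W := fun g => if h : ∃ w, g w = true then h.choose else Classical.arbitrary W
  let test : Y → W → Bool := fun y w => if y ∈ G w then true else false
  have htest : Measurable test :=
    measurable_pi_lambda _ fun w => Measurable.ite (hG w) measurable_const measurable_const
  refine ⟨pick ∘ test, (Measurable.of_discrete).comp htest, fun y w hw hne => ?_⟩
  have hex : ∃ w, test y w = true := ⟨w, by simp [test, hw]⟩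
  have htestG : ∀ w', test y w' = true → y ∈ G w' := fun w' h => by
    by_contra h'
    simp [test, h'] at h
  simp only [Function.comp_apply, pick, dif_pos hex]
  by_contra hcon
  exact hne _ hcon (htestG _ hex.choose_spec)

variable {U V E Y : Type*} [MeasurableSpace U] [MeasurableSpace V] [MeasurableSpace E]
  [MeasurableSpace Y]

/-- Random superposition coding: `M₁` cloud centres with law `μU`, each carrying `M₂` satellites with
law `μV`. The test `D₂` discriminates between the satellites of one cloud and the test `D₁₂` between
clouds; `T` is the set of typical triples (centre, satellite, noise). Atypical triples count as
errors even when decoded correctly, which leaves room to modify the channel inputs outside `T`. -/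
lemma exists_superposition_code (μU : Measure U) (μV : Measure V) (μE : Measure E)
    [IsProbabilityMeasure μU] [IsProbabilityMeasure μV] [IsProbabilityMeasure μE]
    {F : U × V → E → Y} (hF : Measurable (Function.uncurry F))
    {D₂ D₁₂ : Set ((U × V) × Y)} (hD₂ : MeasurableSet D₂) (hD₁₂ : MeasurableSet D₁₂)
    {T : Set ((U × V) × E)} (hT : MeasurableSet T)
    (hTD₂ : ∀ p e, (p, e) ∈ T → (p, F p e) ∈ D₂) (hTD₁₂ : ∀ p e, (p, e) ∈ T → (p, F p e) ∈ D₁₂)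
    {q₀ q₂ q₁₂ : ENNReal} (hq₀ : ((μU.prod μV).prod μE) Tᶜ ≤ q₀)
    (hq₂ : ∀ u y, μV {v | ((u, v), y) ∈ D₂} ≤ q₂)
    (hq₁₂ : ∀ y, (μU.prod μV) {p | (p, y) ∈ D₁₂} ≤ q₁₂)
    {M₁ M₂ : ℕ} (hM₁ : 0 < M₁) (hM₂ : 0 < M₂) :
    ∃ (u : Fin M₁ → U) (v : Fin M₁ → Fin M₂ → V) (dec : Y → Fin M₁ × Fin M₂), Measurable dec ∧
      ∑ w₁, ∑ w₂, μE {e | dec (F (u w₁, v w₁ w₂) e) ≠ (w₁, w₂) ∨ ((u w₁, v w₁ w₂), e) ∉ T} ≤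
        M₁ * (M₂ * (q₀ + (M₂ - 1 : ℕ) * q₂ + (M₁ - 1 : ℕ) * (M₂ * q₁₂))) := by
  classical
  let μB : Measure (U × (Fin M₂ → V)) := μU.prod (Measure.pi fun _ => μV)
  let μ : Measure (Fin M₁ → U × (Fin M₂ → V)) := Measure.pi fun _ => μB
  -- the pair (centre, satellite) of one message
  have hblock : ∀ w₂ : Fin M₂, MeasurePreserving
      (fun b : U × (Fin M₂ → V) => (b.1, b.2 w₂)) μB (μU.prod μV) := fun w₂ =>
    (MeasurePreserving.id μU).prod (measurePreserving_eval (fun _ : Fin M₂ => μV) w₂)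
  have hpair : ∀ (w₁ : Fin M₁) (w₂ : Fin M₂), MeasurePreserving
      (fun C : Fin M₁ → U × (Fin M₂ → V) => ((C w₁).1, (C w₁).2 w₂)) μ (μU.prod μV) :=
    fun w₁ w₂ => (hblock w₂).comp (measurePreserving_eval (fun _ : Fin M₁ => μB) w₁)
  have hsat : ∀ (w₁ : Fin M₁) {w₂ w₂' : Fin M₂}, w₂ ≠ w₂' → MeasurePreserving
      (fun C : Fin M₁ → U × (Fin M₂ → V) => (((C w₁).1, (C w₁).2 w₂), (C w₁).2 w₂')) μ
      ((μU.prod μV).prod μV) := fun w₁ w₂ w₂' h =>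
    (measurePreserving_prodAssoc μU μV μV).symm.comp
      (((MeasurePreserving.id μU).prod (measurePreserving_eval_pair μV h)).comp
        (measurePreserving_eval (fun _ : Fin M₁ => μB) w₁))
  have hcloud : ∀ {w₁ w₁' : Fin M₁} (w₂ w₂' : Fin M₂), w₁ ≠ w₁' → MeasurePreserving
      (fun C : Fin M₁ → U × (Fin M₂ → V) =>
        (((C w₁).1, (C w₁).2 w₂), ((C w₁').1, (C w₁').2 w₂'))) μ
      ((μU.prod μV).prod (μU.prod μV)) := fun w₂ w₂' h =>
    ((hblock w₂).prod (hblock w₂')).comp (measurePreserving_eval_pair μB h)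
  let S₂ : Set (((U × V) × V) × E) := {x | ((x.1.1.1, x.1.2), F x.1.1 x.2) ∈ D₂}
  let S₁₂ : Set (((U × V) × (U × V)) × E) := {x | (x.1.2, F x.1.1 x.2) ∈ D₁₂}
  have hS₂ : MeasurableSet S₂ := by
    have hF' : Measurable fun x : ((U × V) × V) × E => F x.1.1 x.2 :=
      hF.comp (by fun_prop : Measurable fun x : ((U × V) × V) × E => (x.1.1, x.2))
    exact hD₂.preimage (by fun_prop : Measurable fun x : ((U × V) × V) × E =>
      ((x.1.1.1, x.1.2), F x.1.1 x.2))
  have hS₁₂ : MeasurableSet S₁₂ := by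
    have hF' : Measurable fun x : ((U × V) × (U × V)) × E => F x.1.1 x.2 :=
      hF.comp (by fun_prop : Measurable fun x : ((U × V) × (U × V)) × E => (x.1.1, x.2))
    exact hD₁₂.preimage (by fun_prop : Measurable fun x : ((U × V) × (U × V)) × E =>
      (x.1.2, F x.1.1 x.2))
  have mT : Measurable fun p : U × V => μE {e | (p, e) ∈ Tᶜ} :=
    measurable_measure_prodMk_left hT.compl
  have mS₂ : Measurable fun p : (U × V) × V => μE {e | (p, e) ∈ S₂} :=
    measurable_measure_prodMk_left hS₂
  have mS₁₂ : Measurable fun p : (U × V) × (U × V) => μE {e | (p, e) ∈ S₁₂} :=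
    measurable_measure_prodMk_left hS₁₂
  -- the union bound for the error probability of one message under the codebook `C`
  let bound : Fin M₁ → Fin M₂ → (Fin M₁ → U × (Fin M₂ → V)) → ENNReal := fun w₁ w₂ C =>
    μE {e | (((C w₁).1, (C w₁).2 w₂), e) ∈ Tᶜ} +
    ∑ w₂' ∈ Finset.univ.erase w₂, μE {e | ((((C w₁).1, (C w₁).2 w₂), (C w₁).2 w₂'), e) ∈ S₂} +
    ∑ w₁' ∈ Finset.univ.erase w₁, ∑ w₂',
      μE {e | ((((C w₁).1, (C w₁).2 w₂), ((C w₁').1, (C w₁').2 w₂')), e) ∈ S₁₂}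
  have m1 : ∀ w₁ w₂, Measurable fun C : Fin M₁ → U × (Fin M₂ → V) =>
      μE {e | (((C w₁).1, (C w₁).2 w₂), e) ∈ Tᶜ} := fun w₁ w₂ => mT.comp (hpair w₁ w₂).measurable
  have m2 : ∀ w₁ w₂ w₂', Measurable fun C : Fin M₁ → U × (Fin M₂ → V) =>
      μE {e | ((((C w₁).1, (C w₁).2 w₂), (C w₁).2 w₂'), e) ∈ S₂} := fun w₁ w₂ w₂' =>
    mS₂.comp (by fun_prop : Measurable fun C : Fin M₁ → U × (Fin M₂ → V) =>
      (((C w₁).1, (C w₁).2 w₂), (C w₁).2 w₂'))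
  have m3 : ∀ w₁ w₂ w₁' w₂', Measurable fun C : Fin M₁ → U × (Fin M₂ → V) =>
      μE {e | ((((C w₁).1, (C w₁).2 w₂), ((C w₁').1, (C w₁').2 w₂')), e) ∈ S₁₂} :=
    fun w₁ w₂ w₁' w₂' =>
    mS₁₂.comp (by fun_prop : Measurable fun C : Fin M₁ → U × (Fin M₂ → V) =>
      (((C w₁).1, (C w₁).2 w₂), ((C w₁').1, (C w₁').2 w₂')))
  have m23 : ∀ w₁ w₂, Measurable fun C : Fin M₁ → U × (Fin M₂ → V) =>
      ∑ w₂' ∈ Finset.univ.erase w₂,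
        μE {e | ((((C w₁).1, (C w₁).2 w₂), (C w₁).2 w₂'), e) ∈ S₂} := fun w₁ w₂ =>
    Finset.measurable_sum _ fun w₂' _ => m2 w₁ w₂ w₂'
  have m33 : ∀ w₁ w₂ w₁', Measurable fun C : Fin M₁ → U × (Fin M₂ → V) =>
      ∑ w₂', μE {e | ((((C w₁).1, (C w₁).2 w₂), ((C w₁').1, (C w₁').2 w₂')), e) ∈ S₁₂} :=
    fun w₁ w₂ w₁' => Finset.measurable_sum _ fun w₂' _ => m3 w₁ w₂ w₁' w₂'
  have m333 : ∀ w₁ w₂, Measurable fun C : Fin M₁ → U × (Fin M₂ → V) =>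
      ∑ w₁' ∈ Finset.univ.erase w₁, ∑ w₂',
        μE {e | ((((C w₁).1, (C w₁).2 w₂), ((C w₁').1, (C w₁').2 w₂')), e) ∈ S₁₂} :=
    fun w₁ w₂ => Finset.measurable_sum _ fun w₁' _ => m33 w₁ w₂ w₁'
  have mbound : ∀ w₁ w₂, Measurable (bound w₁ w₂) := fun w₁ w₂ =>
    ((m1 w₁ w₂).add (m23 w₁ w₂)).add (m333 w₁ w₂)
  have hbound : ∀ w₁ w₂, ∫⁻ C, bound w₁ w₂ C ∂μ ≤
      q₀ + (M₂ - 1 : ℕ) * q₂ + (M₁ - 1 : ℕ) * (M₂ * q₁₂) := by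
    intro w₁ w₂
    simp only [bound]
    rw [lintegral_add_left ((m1 w₁ w₂).fun_add (m23 w₁ w₂)), lintegral_add_left (m1 w₁ w₂),
      lintegral_finsetSum _ fun w₂' _ => m2 w₁ w₂ w₂',
      lintegral_finsetSum _ fun w₁' _ => m33 w₁ w₂ w₁']
    refine add_le_add (add_le_add ?_ ?_) ?_
    · rw [(hpair w₁ w₂).lintegral_comp mT]
      exact (Measure.prod_apply hT.compl).symm.le.trans hq₀
    · have : ∀ w₂' ∈ Finset.univ.erase w₂,
          ∫⁻ C, μE {e | ((((C w₁).1, (C w₁).2 w₂), (C w₁).2 w₂'), e) ∈ S₂} ∂μ ≤ q₂ := by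
        intro w₂' h
        rw [(hsat w₁ (Finset.ne_of_mem_erase h).symm).lintegral_comp mS₂]
        exact lintegral_measure_le_of_indep _ _ _ hS₂ fun p e => hq₂ p.1 (F p e)
      refine (Finset.sum_le_card_nsmul _ _ _ this).trans ?_
      rw [Finset.card_erase_of_mem (Finset.mem_univ _), Finset.card_univ, Fintype.card_fin,
        nsmul_eq_mul]
    · have : ∀ w₁' ∈ Finset.univ.erase w₁, ∫⁻ C, ∑ w₂',
          μE {e | ((((C w₁).1, (C w₁).2 w₂), ((C w₁').1, (C w₁').2 w₂')), e) ∈ S₁₂} ∂μ ≤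
          M₂ * q₁₂ := by
        intro w₁' h
        rw [lintegral_finsetSum _ fun w₂' _ => m3 w₁ w₂ w₁' w₂']
        refine (Finset.sum_le_card_nsmul _ _ q₁₂ fun w₂' _ => ?_).trans (by simp)
        rw [(hcloud w₂ w₂' (Finset.ne_of_mem_erase h).symm).lintegral_comp mS₁₂]
        exact lintegral_measure_le_of_indep _ _ _ hS₁₂ fun p e => hq₁₂ (F p e)
      refine (Finset.sum_le_card_nsmul _ _ _ this).trans ?_
      rw [Finset.card_erase_of_mem (Finset.mem_univ _), Finset.card_univ, Fintype.card_fin,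
        nsmul_eq_mul]
  obtain ⟨C, hC⟩ := exists_le_lintegral (μ := μ) (f := fun C => ∑ w₁, ∑ w₂, bound w₁ w₂ C)
    (Finset.measurable_sum _ fun w₁ _ => Finset.measurable_sum _ fun w₂ _ =>
      mbound w₁ w₂).aemeasurable
  rw [lintegral_finsetSum _ fun w₁ _ => Finset.measurable_sum _ fun w₂ _ => mbound w₁ w₂] at hC
  simp_rw [lintegral_finsetSum Finset.univ fun w₂ (_ : w₂ ∈ Finset.univ) => mbound _ w₂] at hC
  have : Nonempty (Fin M₁ × Fin M₂) := ⟨(⟨0, hM₁⟩, ⟨0, hM₂⟩)⟩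
  obtain ⟨dec, hdec, hdec'⟩ := exists_measurable_decoder (W := Fin M₁ × Fin M₂)
    (G := fun w => {y | (((C w.1).1, (C w.1).2 w.2), y) ∈ D₂} ∩
      {y | (((C w.1).1, (C w.1).2 w.2), y) ∈ D₁₂})
    (fun w => (measurable_prodMk_left hD₂).inter (measurable_prodMk_left hD₁₂))
  refine ⟨fun w₁ => (C w₁).1, fun w₁ => (C w₁).2, dec, hdec, ?_⟩
  calc _ ≤ ∑ w₁, ∑ w₂, bound w₁ w₂ C := ?_
    _ ≤ _ := hC
    _ ≤ _ := Finset.sum_le_sum fun w₁ _ => Finset.sum_le_sum fun w₂ _ => hbound w₁ w₂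
    _ = _ := by simp only [Finset.sum_const, Finset.card_univ, Fintype.card_fin, nsmul_eq_mul]
  refine Finset.sum_le_sum fun w₁ _ => Finset.sum_le_sum fun w₂ _ => ?_
  have hsub : {e | dec (F ((C w₁).1, (C w₁).2 w₂) e) ≠ (w₁, w₂) ∨
      (((C w₁).1, (C w₁).2 w₂), e) ∉ T} ⊆
      ({e | (((C w₁).1, (C w₁).2 w₂), e) ∈ Tᶜ} ∪
      ⋃ w₂' ∈ Finset.univ.erase w₂, {e | ((((C w₁).1, (C w₁).2 w₂), (C w₁).2 w₂'), e) ∈ S₂}) ∪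
      ⋃ w₁' ∈ Finset.univ.erase w₁, ⋃ w₂' ∈ (Finset.univ : Finset (Fin M₂)),
        {e | ((((C w₁).1, (C w₁).2 w₂), ((C w₁').1, (C w₁').2 w₂')), e) ∈ S₁₂} := by
    intro e he
    by_contra hcon
    simp only [Set.mem_union, Set.mem_iUnion, not_or, not_exists, Finset.mem_erase,
      Finset.mem_univ, and_true] at hcon
    obtain ⟨⟨hT', h2⟩, h12⟩ := hcon
    have hTe : (((C w₁).1, (C w₁).2 w₂), e) ∈ T := not_not.1 hT'
    refine he.elim (fun hne => hne ?_) fun h => h hTe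
    refine hdec' _ _ ⟨hTD₂ _ _ hTe, hTD₁₂ _ _ hTe⟩ ?_
    rintro ⟨w₁', w₂'⟩ hw ⟨hy2, hy12⟩
    by_cases h1 : w₁' = w₁
    · subst h1
      exact h2 w₂' (fun h => hw (by rw [h])) hy2
    · exact h12 w₁' h1 w₂' trivial hy12
  refine (measure_mono hsub).trans ((measure_union_le _ _).trans (add_le_add
    ((measure_union_le _ _).trans (add_le_add le_rfl (measure_biUnion_finset_le _ _))) ?_))
  exact (measure_biUnion_finset_le _ _).trans
    (Finset.sum_le_sum fun w₁' _ => measure_biUnion_finset_le _ _)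

end RandomCoding

/-! ### Gaussian information densities -/

/-- The information density, for one channel use, of the input symbol `t` and the output `r` of the
channel `r = b t + noise` with standard Gaussian `t` and Gaussian noise of variance `s`. -/
noncomputable def infoDensity (b s r t : ℝ) : ℝ :=
  1 / 2 * Real.log ((s + b ^ 2) / s) + r ^ 2 / (2 * (s + b ^ 2)) - (r - b * t) ^ 2 / (2 * s)

/-- The posterior density of a Gaussian input given the output is Gaussian. -/
lemma gaussianPDF_mul_exp_infoDensity (b : ℝ) {s : ℝ} (hs : 0 < s) (r t : ℝ) :
    gaussianPDF 0 1 t * ENNReal.ofReal (Real.exp (infoDensity b s r t)) =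
      gaussianPDF (b * r / (s + b ^ 2)) (s / (s + b ^ 2)).toNNReal t := by
  have hsb : 0 < s + b ^ 2 := by positivity
  rw [gaussianPDF, gaussianPDF, ← ENNReal.ofReal_mul (gaussianPDFReal_nonneg _ _ _)]
  congr 1
  rw [gaussianPDFReal, gaussianPDFReal, Real.coe_toNNReal _ (by positivity), mul_assoc,
    ← Real.exp_add]
  have h2 : Real.exp (1 / 2 * Real.log ((s + b ^ 2) / s)) = √((s + b ^ 2) / s) := by
    rw [Real.sqrt_eq_rpow, Real.rpow_def_of_pos (div_pos hsb hs), mul_comm]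
  have h1 : -(t - 0) ^ 2 / (2 * ((1 : NNReal) : ℝ)) + infoDensity b s r t =
      1 / 2 * Real.log ((s + b ^ 2) / s) +
        -(t - b * r / (s + b ^ 2)) ^ 2 / (2 * (s / (s + b ^ 2))) := by
    rw [infoDensity]
    simp only [NNReal.coe_one]
    field_simp
    ring
  rw [h1, Real.exp_add, h2, ← mul_assoc]
  congr 1
  have h3 : 2 * Real.pi * ((1 : NNReal) : ℝ) =
      (2 * Real.pi * (s / (s + b ^ 2))) * ((s + b ^ 2) / s) := by
    simp only [NNReal.coe_one]
    field_simp
  have h4 : √((s + b ^ 2) / s) ≠ 0 := (Real.sqrt_pos.2 (by positivity)).ne'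
  rw [h3, Real.sqrt_mul (by positivity), mul_inv, mul_assoc, inv_mul_cancel₀ h4, mul_one]

lemma lintegral_exp_infoDensity (b : ℝ) {s : ℝ} (hs : 0 < s) (r : ℝ) :
    ∫⁻ t, ENNReal.ofReal (Real.exp (infoDensity b s r t)) ∂(gaussianReal 0 1) = 1 := by
  have hsb : 0 < s + b ^ 2 := by positivity
  have hm : Measurable fun t => ENNReal.ofReal (Real.exp (infoDensity b s r t)) := by
    unfold infoDensity
    fun_prop
  rw [gaussianReal_of_var_ne_zero 0 one_ne_zero, lintegral_withDensity_eq_lintegral_mul _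
    (measurable_gaussianPDF 0 1) hm]
  simp_rw [Pi.mul_apply, gaussianPDF_mul_exp_infoDensity b hs]
  exact lintegral_gaussianPDF_eq_one _ (by simpa using div_pos hs hsb)

/-- A wrong codeword, independent of the output, has exponential information density of mean one. -/
lemma lintegral_exp_sum_infoDensity (b : ℝ) {s : ℝ} (hs : 0 < s) {N : ℕ} (r : Fin N → ℝ) :
    ∫⁻ t, ENNReal.ofReal (Real.exp (∑ i, infoDensity b s (r i) (t i)))
      ∂(Measure.pi fun _ : Fin N => gaussianReal 0 1) = 1 := by
  simp_rw [Real.exp_sum, ENNReal.ofReal_prod_of_nonneg fun _ _ => (Real.exp_pos _).le]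
  rw [lintegral_pi_prod _ (fun i t => ENNReal.ofReal (Real.exp (infoDensity b s (r i) t)))
    fun i => by unfold infoDensity; fun_prop]
  simp [lintegral_exp_infoDensity b hs]

/-- Markov's inequality for exponential moments. -/
lemma measure_le_exp_neg {Ω : Type*} [MeasurableSpace Ω] {μ : Measure Ω} {f : Ω → ℝ}
    (hf : Measurable f) (h : ∫⁻ ω, ENNReal.ofReal (Real.exp (f ω)) ∂μ ≤ 1) (t : ℝ) :
    μ {ω | t ≤ f ω} ≤ ENNReal.ofReal (Real.exp (-t)) := by
  have hm := mul_meas_ge_le_lintegral (μ := μ) (Real.measurable_exp.comp hf).ennreal_ofReal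
    (ENNReal.ofReal (Real.exp t))
  have hsub : μ {ω | t ≤ f ω} ≤
      μ {ω | ENNReal.ofReal (Real.exp t) ≤ ENNReal.ofReal ((Real.exp ∘ f) ω)} :=
    measure_mono fun ω (hω : t ≤ f ω) =>
      ENNReal.ofReal_le_ofReal (Real.exp_le_exp.2 hω)
  rw [Real.exp_neg, ENNReal.ofReal_inv_of_pos (Real.exp_pos t), ENNReal.le_inv_iff_mul_le, mul_comm]
  exact (mul_le_mul_right hsub _).trans (hm.trans h)

/-! ### Law of large numbers -/

/-- The weak law of large numbers for product measures, one-sided, from Chebyshev's inequality. -/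
lemma exists_pi_sum_ge_le {Ω : Type*} [MeasurableSpace Ω] (ν : Measure Ω) [IsProbabilityMeasure ν]
    {f : Ω → ℝ} (hf : MemLp f 2 ν) {a : ℝ} (ha : ∫ ω, f ω ∂ν < a) {ε : ℝ} (hε : 0 < ε) :
    ∃ N₀ : ℕ, ∀ N ≥ N₀, (Measure.pi fun _ : Fin N => ν) {x | N * a ≤ ∑ i, f (x i)} ≤
      ENNReal.ofReal ε := by
  set δ := a - ∫ ω, f ω ∂ν with hδ
  have hδ0 : 0 < δ := sub_pos.2 ha
  obtain ⟨N₀, hN₀⟩ := exists_nat_gt (Var[f; ν] / (δ ^ 2 * ε))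
  refine ⟨N₀ + 1, fun N hN => ?_⟩
  have hNpos : (0 : ℝ) < N := by exact_mod_cast (by omega : 0 < N)
  have hNN : (N₀ : ℝ) ≤ N := by exact_mod_cast (by omega : N₀ ≤ N)
  have hmem : ∀ i : Fin N, MemLp (fun x : Fin N → Ω => f (x i)) 2 (Measure.pi fun _ => ν) :=
    fun i => hf.comp_measurePreserving (measurePreserving_eval (fun _ : Fin N => ν) i)
  have hsum : MemLp (∑ i : Fin N, fun x : Fin N → Ω => f (x i)) 2 (Measure.pi fun _ => ν) :=
    memLp_finsetSum' _ fun i _ => hmem i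
  have hvar := variance_sum_pi (μ := fun _ : Fin N => ν) (X := fun _ => f) fun _ => hf
  have hint : ∫ x, (∑ i : Fin N, fun x : Fin N → Ω => f (x i)) x ∂(Measure.pi fun _ => ν) =
      N * ∫ ω, f ω ∂ν := by
    simp only [Finset.sum_apply]
    rw [integral_finsetSum _ fun i _ => (hmem i).integrable one_le_two]
    have : ∀ i : Fin N, ∫ x : Fin N → Ω, f (x i) ∂(Measure.pi fun _ => ν) = ∫ ω, f ω ∂ν := by
      intro i
      have hR := measurePreserving_eval (fun _ : Fin N => ν) i
      have h := integral_map (μ := Measure.pi fun _ : Fin N => ν) hR.measurable.aemeasurable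
        (f := f) (by rw [hR.map_eq]; exact hf.aestronglyMeasurable)
      rw [hR.map_eq] at h
      exact h.symm
    simp [this]
  have hcheb := meas_ge_le_variance_div_sq hsum (c := N * δ) (by positivity)
  rw [hvar, hint] at hcheb
  refine (measure_mono fun x hx => ?_).trans (hcheb.trans (ENNReal.ofReal_le_ofReal ?_))
  · simp only [Set.mem_ofPred_eq, Finset.sum_apply] at hx ⊢
    refine le_trans ?_ (le_abs_self _)
    rw [hδ]
    linarith
  · simp only [Finset.sum_const, Finset.card_univ, Fintype.card_fin, nsmul_eq_mul]
    rw [div_lt_iff₀ (by positivity)] at hN₀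
    rw [div_le_iff₀ (by positivity)]
    have : (N₀ : ℝ) * (δ ^ 2 * ε) ≤ N * (δ ^ 2 * ε) :=
      mul_le_mul_of_nonneg_right hNN (by positivity)
    nlinarith

/-! ### The Gaussian test channel -/

/-- The joint law of a centre symbol, a satellite symbol and the noise in one channel use. -/
noncomputable def letterLaw (σ : ℝ) : Measure ((ℝ × ℝ) × ℝ) :=
  ((gaussianReal 0 1).prod (gaussianReal 0 1)).prod (gaussianReal 0 (σ ^ 2).toNNReal)

instance isProbabilityMeasure_letterLaw (σ : ℝ) : IsProbabilityMeasure (letterLaw σ) := by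
  unfold letterLaw; infer_instance

lemma integral_add_mul_sq_gaussianReal (v : NNReal) (x c : ℝ) :
    ∫ t, (x + c * t) ^ 2 ∂(gaussianReal 0 v) = x ^ 2 + c ^ 2 * v := by
  have h2 : Integrable (fun t : ℝ => t ^ 2) (gaussianReal 0 v) :=
    (memLp_id_gaussianReal 2).integrable_sq
  have h1 : Integrable (fun t : ℝ => t) (gaussianReal 0 v) :=
    (memLp_id_gaussianReal 1).integrable le_rfl
  have : ∀ t, (x + c * t) ^ 2 = x ^ 2 + 2 * x * c * t + c ^ 2 * t ^ 2 := fun t => by ring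
  simp_rw [this]
  rw [integral_add ((integrable_const _).fun_add (h1.const_mul _)) (h2.const_mul _),
    integral_add (integrable_const _) (h1.const_mul _), integral_const_mul, integral_const_mul,
    integral_sq_gaussianReal, integral_id_gaussianReal]
  simp

/-- A linear combination of the centre symbol, the satellite symbol and the noise. -/
def linComb (α β c : ℝ) (ω : (ℝ × ℝ) × ℝ) : ℝ := α * ω.1.1 + β * ω.1.2 + c * ω.2

lemma memLp_linComb_sq (σ α β c : ℝ) :
    MemLp (fun ω => linComb α β c ω ^ 2) 2 (letterLaw σ) := by
  have hu : MemLp (fun ω : (ℝ × ℝ) × ℝ => ω.1.1) 4 (letterLaw σ) :=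
    (memLp_id_gaussianReal 4).comp_measurePreserving
      (measurePreserving_fst.comp measurePreserving_fst)
  have hv : MemLp (fun ω : (ℝ × ℝ) × ℝ => ω.1.2) 4 (letterLaw σ) :=
    (memLp_id_gaussianReal 4).comp_measurePreserving
      (measurePreserving_snd.comp measurePreserving_fst)
  have he : MemLp (fun ω : (ℝ × ℝ) × ℝ => ω.2) 4 (letterLaw σ) :=
    (memLp_id_gaussianReal 4).comp_measurePreserving measurePreserving_snd
  have hl : MemLp (linComb α β c) 4 (letterLaw σ) :=
    ((hu.const_mul α).add (hv.const_mul β)).add (he.const_mul c)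
  have hm : Measurable fun ω => linComb α β c ω ^ 2 := by unfold linComb; fun_prop
  refine (memLp_two_iff_integrable_sq hm.aestronglyMeasurable).2 ?_
  have := MemLp.integrable_norm_pow (p := 4) hl (by norm_num)
  refine this.congr (Filter.Eventually.of_forall fun ω => ?_)
  simp only [Real.norm_eq_abs]
  rw [← pow_mul, Even.pow_abs (by decide)]

lemma integral_linComb_sq (σ α β c : ℝ) :
    ∫ ω, linComb α β c ω ^ 2 ∂(letterLaw σ) = α ^ 2 + β ^ 2 + c ^ 2 * σ ^ 2 := by
  have hi : Integrable (fun ω => linComb α β c ω ^ 2) (letterLaw σ) :=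
    (memLp_linComb_sq σ α β c).integrable one_le_two
  have hi' : Integrable (fun p : ℝ × ℝ => ∫ e, linComb α β c (p, e) ^ 2
      ∂(gaussianReal 0 (σ ^ 2).toNNReal)) ((gaussianReal 0 1).prod (gaussianReal 0 1)) :=
    hi.integral_prod_left
  rw [letterLaw, integral_prod _ hi, integral_prod _ hi']
  simp only [linComb, integral_add_mul_sq_gaussianReal]
  have h1 : ∀ x : ℝ, Integrable (fun t => (x + β * t) ^ 2) (gaussianReal 0 1) := fun x =>
    ((memLp_const x).add ((memLp_id_gaussianReal 2).const_mul β)).integrable_sq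
  simp_rw [fun x => integral_add (h1 x) (integrable_const (c ^ 2 * ((σ ^ 2).toNNReal : ℝ))),
    integral_add_mul_sq_gaussianReal]
  have h2 : Integrable (fun t : ℝ => (α * t) ^ 2) (gaussianReal 0 1) :=
    ((memLp_id_gaussianReal 2).const_mul α).integrable_sq
  rw [integral_add (h2.fun_add (integrable_const _)) (integrable_const _),
    integral_add h2 (integrable_const _)]
  have h3 := integral_add_mul_sq_gaussianReal 1 0 α
  simp only [zero_add] at h3
  rw [h3]
  simp [sq_nonneg]

/-- The law of (centre word, satellite word, noise) is the product over time of the one-letter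
laws. -/
lemma measurePreserving_zip (σ : ℝ) (N : ℕ) :
    MeasurePreserving (fun (x : ((Fin N → ℝ) × (Fin N → ℝ)) × (Fin N → ℝ)) (i : Fin N) =>
      ((x.1.1 i, x.1.2 i), x.2 i))
      (((Measure.pi fun _ => gaussianReal 0 1).prod (Measure.pi fun _ => gaussianReal 0 1)).prod
        (noise σ N)) (Measure.pi fun _ => letterLaw σ) := by
  have e1 := (measurePreserving_arrowProdEquivProdArrow (ℝ × ℝ) ℝ (Fin N)
    (fun _ => (gaussianReal 0 1).prod (gaussianReal 0 1))
    (fun _ => gaussianReal 0 (σ ^ 2).toNNReal)).symm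
  have e2 := (measurePreserving_arrowProdEquivProdArrow ℝ ℝ (Fin N)
    (fun _ => gaussianReal 0 1) (fun _ => gaussianReal 0 1)).symm
  exact e1.comp (e2.prod (MeasurePreserving.id (noise σ N)))

/-- Weak law of large numbers, allowing the trivial case where the bound holds surely. -/
lemma exists_pi_sum_gt_le {Ω : Type*} [MeasurableSpace Ω] (ν : Measure Ω) [IsProbabilityMeasure ν]
    {f : Ω → ℝ} (hf : MemLp f 2 ν) {a : ℝ} (ha : ∫ ω, f ω ∂ν < a ∨ ∀ ω, f ω ≤ a)
    {ε : ℝ} (hε : 0 < ε) :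
    ∃ N₀ : ℕ, ∀ N ≥ N₀, (Measure.pi fun _ : Fin N => ν) {x | N * a < ∑ i, f (x i)} ≤
      ENNReal.ofReal ε := by
  rcases ha with ha | ha
  · obtain ⟨N₀, h⟩ := exists_pi_sum_ge_le ν hf ha hε
    refine ⟨N₀, fun N hN => (measure_mono ?_).trans (h N hN)⟩
    exact fun x (hx : N * a < ∑ i, f (x i)) => hx.le
  · refine ⟨0, fun N _ => ?_⟩
    have : {x : Fin N → Ω | N * a < ∑ i, f (x i)} = ∅ := by
      ext x
      simp only [Set.mem_ofPred_eq, Set.mem_empty_iff_false, iff_false, not_lt]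
      refine (Finset.sum_le_sum fun i _ => ha (x i)).trans ?_
      simp
    rw [this]
    simp

/-! ### Gaussian superposition codes -/

namespace Code

variable {N M₁ M₂ : ℕ} (c : Code N M₁ M₂)

lemma output_toFeedbackCode (w₁ : Fin M₁) (w₂ : Fin M₂) (η : Fin N → ℝ) :
    c.toFeedbackCode.output w₁ w₂ η = fun i => c.enc₁ w₁ i + c.enc₂ w₁ w₂ i + η i := by
  funext i
  rw [FeedbackCode.output_eq]
  rfl

end Code

lemma power_le_of_sum_sq_le {Ω : Type*} [MeasurableSpace Ω] {μ : Measure Ω}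
    [IsProbabilityMeasure μ] {N M₁ M₂ : ℕ} {x : Fin M₁ → Fin M₂ → Fin N → ℝ} {P : ℝ}
    (h : ∀ w₁ w₂, ∑ i, x w₁ w₂ i ^ 2 ≤ N * P) :
    (∑ w₁, ∑ w₂, ∑ i, ∫⁻ _, ENNReal.ofReal (x w₁ w₂ i ^ 2) ∂μ)
      / ((M₁ : ENNReal) * (M₂ : ENNReal) * (N : ENNReal)) ≤ ENNReal.ofReal P := by
  refine ENNReal.div_le_of_le_mul ?_
  have h1 : ∀ w₁ w₂, ∑ i, ∫⁻ _, ENNReal.ofReal (x w₁ w₂ i ^ 2) ∂μ ≤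
      N * ENNReal.ofReal P := by
    intro w₁ w₂
    simp only [lintegral_const, measure_univ, mul_one]
    rw [← ENNReal.ofReal_sum_of_nonneg fun i _ => sq_nonneg _]
    refine (ENNReal.ofReal_le_ofReal (h w₁ w₂)).trans ?_
    rw [ENNReal.ofReal_mul (Nat.cast_nonneg N), ENNReal.ofReal_natCast]
  refine (Finset.sum_le_sum fun w₁ _ => Finset.sum_le_sum fun w₂ _ => h1 w₁ w₂).trans ?_
  simp only [Finset.sum_const, Finset.card_univ, Fintype.card_fin, nsmul_eq_mul]
  exact le_of_eq (by ring)

/-- Existence of good superposition codes: transmitter 1 sends `a₁ U(w₁)` and transmitter 2 sends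
`a₂ U(w₁) + b V(w₁, w₂)` with Gaussian `U`, `V`. Words violating the power constraint are replaced
by zero; since they are atypical, this only adds to the error probability. -/
lemma exists_code {σ P₁ P₂ a₁ a₂ b t₂ t₁₂ : ℝ} (hσ : 0 < σ) (hP₁ : 0 ≤ P₁) (hP₂ : 0 ≤ P₂)
    (h₁ : a₁ ^ 2 < P₁ ∨ a₁ = 0) (h₂ : a₂ ^ 2 + b ^ 2 < P₂ ∨ a₂ = 0 ∧ b = 0)
    (ht₂ : t₂ < 1 / 2 * Real.log (1 + b ^ 2 / σ ^ 2))
    (ht₁₂ : t₁₂ < 1 / 2 * Real.log (1 + ((a₁ + a₂) ^ 2 + b ^ 2) / σ ^ 2)) {ε : ℝ} (hε : 0 < ε) :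
    ∃ N₀ : ℕ, ∀ N ≥ N₀, ∀ M₁ M₂ : ℕ, 0 < M₁ → 0 < M₂ →
      (M₂ - 1 : ℕ) * Real.exp (-(N * t₂)) ≤ ε →
      (M₁ - 1 : ℕ) * (M₂ * Real.exp (-(N * t₁₂))) ≤ ε →
      ∃ c : Code N M₁ M₂, c.toFeedbackCode.power₁ σ ≤ ENNReal.ofReal P₁ ∧
        c.toFeedbackCode.power₂ σ ≤ ENNReal.ofReal P₂ ∧ c.toFeedbackCode.errorProb σ ≤ 6 * ε := by
  classical
  have hv : 0 < σ ^ 2 := by positivity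
  have hvb : 0 < σ ^ 2 + b ^ 2 := by positivity
  set a := a₁ + a₂ with ha
  have hτ : 0 < σ ^ 2 + b ^ 2 + a ^ 2 := by positivity
  let i₂ : (ℝ × ℝ) × ℝ → ℝ := fun z => infoDensity b (σ ^ 2) (z.2 - a * z.1.1) z.1.2
  let i₁ : (ℝ × ℝ) × ℝ → ℝ := fun z => infoDensity a (σ ^ 2 + b ^ 2) z.2 z.1.1
  let y : (ℝ × ℝ) × ℝ → ℝ := fun ω => a * ω.1.1 + b * ω.1.2 + ω.2
  let f : Fin 4 → (ℝ × ℝ) × ℝ → ℝ := ![fun ω => (a₁ * ω.1.1) ^ 2,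
    fun ω => (a₂ * ω.1.1 + b * ω.1.2) ^ 2, fun ω => -i₂ (ω.1, y ω),
    fun ω => -(i₂ (ω.1, y ω) + i₁ (ω.1, y ω))]
  let lim : Fin 4 → ℝ := ![P₁, P₂, -t₂, -t₁₂]
  have mi₂ : Measurable i₂ := by simp only [i₂, infoDensity]; fun_prop
  have mi₁ : Measurable i₁ := by simp only [i₁, infoDensity]; fun_prop
  have my : Measurable y := by fun_prop
  have mi₂y : Measurable fun ω : (ℝ × ℝ) × ℝ => i₂ (ω.1, y ω) :=
    mi₂.comp (measurable_fst.prodMk my)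
  have mi₁y : Measurable fun ω : (ℝ × ℝ) × ℝ => i₁ (ω.1, y ω) :=
    mi₁.comp (measurable_fst.prodMk my)
  have mf : ∀ k, Measurable (f k) := by
    intro k
    fin_cases k
    · change Measurable fun ω : (ℝ × ℝ) × ℝ => (a₁ * ω.1.1) ^ 2
      fun_prop
    · change Measurable fun ω : (ℝ × ℝ) × ℝ => (a₂ * ω.1.1 + b * ω.1.2) ^ 2
      fun_prop
    · exact mi₂y.neg
    · exact (mi₂y.add mi₁y).neg
  -- each statistic is a combination of squares of linear forms
  have f0 : f 0 = fun ω => linComb a₁ 0 0 ω ^ 2 := by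
    funext ω; simp [f, linComb]
  have f1 : f 1 = fun ω => linComb a₂ b 0 ω ^ 2 := by
    funext ω; simp [f, linComb]
  have f2 : f 2 = fun ω => -(1 / 2 * Real.log (1 + b ^ 2 / σ ^ 2)) +
      ((2 * σ ^ 2)⁻¹ * linComb 0 0 1 ω ^ 2 - (2 * (σ ^ 2 + b ^ 2))⁻¹ * linComb 0 b 1 ω ^ 2) := by
    funext ω
    have e : (σ ^ 2 + b ^ 2) / σ ^ 2 = 1 + b ^ 2 / σ ^ 2 := by field_simp
    simp only [f, i₂, y, infoDensity, linComb, Matrix.cons_val, e]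
    ring
  have f3 : f 3 = fun ω => -(1 / 2 * Real.log (1 + (a ^ 2 + b ^ 2) / σ ^ 2)) +
      ((2 * σ ^ 2)⁻¹ * linComb 0 0 1 ω ^ 2 -
        (2 * (σ ^ 2 + b ^ 2 + a ^ 2))⁻¹ * linComb a b 1 ω ^ 2) := by
    funext ω
    have e : Real.log ((σ ^ 2 + b ^ 2) / σ ^ 2) +
        Real.log ((σ ^ 2 + b ^ 2 + a ^ 2) / (σ ^ 2 + b ^ 2)) =
        Real.log (1 + (a ^ 2 + b ^ 2) / σ ^ 2) := by
      rw [← Real.log_mul (by positivity) (by positivity)]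
      congr 1
      field_simp
      ring
    simp only [f, i₂, i₁, y, infoDensity, linComb, Matrix.cons_val, ← e]
    ring
  have hL2 : ∀ c₀ c₁ c₂ α β : ℝ, MemLp (fun ω => c₀ + (c₁ * linComb 0 0 1 ω ^ 2 -
      c₂ * linComb α β 1 ω ^ 2)) 2 (letterLaw σ) := fun c₀ c₁ c₂ α β =>
    (memLp_const c₀).add (((memLp_linComb_sq σ 0 0 1).const_mul c₁).sub
      ((memLp_linComb_sq σ α β 1).const_mul c₂))
  have hE : ∀ c₀ c₁ c₂ α β : ℝ, ∫ ω, (c₀ + (c₁ * linComb 0 0 1 ω ^ 2 -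
      c₂ * linComb α β 1 ω ^ 2)) ∂(letterLaw σ) =
      c₀ + (c₁ * σ ^ 2 - c₂ * (α ^ 2 + β ^ 2 + σ ^ 2)) := by
    intro c₀ c₁ c₂ α β
    have i1 := (memLp_linComb_sq σ 0 0 1).integrable one_le_two
    have i2 := (memLp_linComb_sq σ α β 1).integrable one_le_two
    rw [integral_add (f := fun _ => c₀)
        (g := fun ω => c₁ * linComb 0 0 1 ω ^ 2 - c₂ * linComb α β 1 ω ^ 2)
        (integrable_const _) ((i1.const_mul c₁).sub (i2.const_mul c₂)),
      integral_sub (i1.const_mul c₁) (i2.const_mul c₂), integral_const_mul, integral_const_mul,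
      integral_linComb_sq, integral_linComb_sq]
    simp
  have hf : ∀ k, MemLp (f k) 2 (letterLaw σ) := by
    intro k
    fin_cases k
    · change MemLp (f 0) _ _
      rw [f0]; exact memLp_linComb_sq _ _ _ _
    · change MemLp (f 1) _ _
      rw [f1]; exact memLp_linComb_sq _ _ _ _
    · change MemLp (f 2) _ _
      rw [f2]; exact hL2 _ _ _ _ _
    · change MemLp (f 3) _ _
      rw [f3]; exact hL2 _ _ _ _ _
  have hlim : ∀ k, ∫ ω, f k ω ∂(letterLaw σ) < lim k ∨ ∀ ω, f k ω ≤ lim k := by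
    intro k
    fin_cases k
    · change ∫ ω, f 0 ω ∂(letterLaw σ) < P₁ ∨ ∀ ω, f 0 ω ≤ P₁
      rw [f0, integral_linComb_sq]
      refine h₁.imp (fun h => by simpa using h) fun h ω => ?_
      simpa [h, linComb] using hP₁
    · change ∫ ω, f 1 ω ∂(letterLaw σ) < P₂ ∨ ∀ ω, f 1 ω ≤ P₂
      rw [f1, integral_linComb_sq]
      refine h₂.imp (fun h => by simpa using h) fun h ω => ?_
      simpa [h.1, h.2, linComb] using hP₂
    · left
      change ∫ ω, f 2 ω ∂(letterLaw σ) < -t₂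
      rw [f2, hE]
      have : (2 * σ ^ 2)⁻¹ * σ ^ 2 - (2 * (σ ^ 2 + b ^ 2))⁻¹ * (0 ^ 2 + b ^ 2 + σ ^ 2) = 0 := by
        field_simp
        ring
      rw [this]
      linarith
    · left
      change ∫ ω, f 3 ω ∂(letterLaw σ) < -t₁₂
      rw [f3, hE]
      have : (2 * σ ^ 2)⁻¹ * σ ^ 2 -
          (2 * (σ ^ 2 + b ^ 2 + a ^ 2))⁻¹ * (a ^ 2 + b ^ 2 + σ ^ 2) = 0 := by
        field_simp
        ring
      rw [this]
      linarith
  choose N₀ hN₀ using fun k => exists_pi_sum_gt_le (letterLaw σ) (hf k) (hlim k) hε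
  refine ⟨∑ k, N₀ k, fun N hN M₁ M₂ hM₁ hM₂ hq₂ hq₁₂ => ?_⟩
  have hLLN : ∀ k, (Measure.pi fun _ : Fin N => letterLaw σ) {x | N * lim k < ∑ i, f k (x i)} ≤
      ENNReal.ofReal ε := fun k =>
    hN₀ k N ((Finset.single_le_sum (fun _ _ => Nat.zero_le _) (Finset.mem_univ k)).trans hN)
  let γ : Measure (Fin N → ℝ) := Measure.pi fun _ => gaussianReal 0 1
  let zip : ((Fin N → ℝ) × (Fin N → ℝ)) × (Fin N → ℝ) → Fin N → (ℝ × ℝ) × ℝ :=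
    fun x i => ((x.1.1 i, x.1.2 i), x.2 i)
  have hzip : MeasurePreserving zip ((γ.prod γ).prod (noise σ N))
      (Measure.pi fun _ => letterLaw σ) := measurePreserving_zip σ N
  have hzipi : ∀ i, Measurable fun x => zip x i := fun i => (measurable_pi_apply i).comp
    hzip.measurable
  let F : (Fin N → ℝ) × (Fin N → ℝ) → (Fin N → ℝ) → Fin N → ℝ :=
    fun p e i => a * p.1 i + b * p.2 i + e i
  have hF : Measurable (Function.uncurry F) := by
    refine measurable_pi_lambda _ fun i => ?_
    simp only [Function.uncurry, F]
    fun_prop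
  let T : Set (((Fin N → ℝ) × (Fin N → ℝ)) × (Fin N → ℝ)) :=
    {x | ∀ k, ∑ i, f k (zip x i) ≤ N * lim k}
  let D₂ : Set (((Fin N → ℝ) × (Fin N → ℝ)) × (Fin N → ℝ)) := {x | N * t₂ ≤ ∑ i, i₂ (zip x i)}
  let D₁₂ : Set (((Fin N → ℝ) × (Fin N → ℝ)) × (Fin N → ℝ)) :=
    {x | N * t₁₂ ≤ ∑ i, i₂ (zip x i) + ∑ i, i₁ (zip x i)}
  have ms₂ : Measurable fun x => ∑ i, i₂ (zip x i) :=
    Finset.measurable_sum _ fun i _ => mi₂.comp (hzipi i)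
  have ms₁ : Measurable fun x => ∑ i, i₁ (zip x i) :=
    Finset.measurable_sum _ fun i _ => mi₁.comp (hzipi i)
  have hD₂ : MeasurableSet D₂ := measurableSet_le measurable_const ms₂
  have hD₁₂ : MeasurableSet D₁₂ := measurableSet_le measurable_const (ms₂.add ms₁)
  have hT : MeasurableSet T := by
    have : T = ⋂ k, {x | ∑ i, f k (zip x i) ≤ N * lim k} := by ext; simp [T]
    rw [this]
    exact MeasurableSet.iInter fun k => measurableSet_le
      (Finset.measurable_sum _ fun i _ => (mf k).comp (hzipi i)) measurable_const
  have hTD₂ : ∀ p e, (p, e) ∈ T → (p, F p e) ∈ D₂ := by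
    intro p e h
    have h2 : ∑ i, -i₂ (zip (p, F p e) i) ≤ N * -t₂ := h 2
    rw [Finset.sum_neg_distrib] at h2
    change N * t₂ ≤ ∑ i, i₂ (zip (p, F p e) i)
    linarith
  have hTD₁₂ : ∀ p e, (p, e) ∈ T → (p, F p e) ∈ D₁₂ := by
    intro p e h
    have h3 : ∑ i, -(i₂ (zip (p, F p e) i) + i₁ (zip (p, F p e) i)) ≤ N * -t₁₂ := h 3
    rw [Finset.sum_neg_distrib, Finset.sum_add_distrib] at h3
    change N * t₁₂ ≤ ∑ i, i₂ (zip (p, F p e) i) + ∑ i, i₁ (zip (p, F p e) i)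
    linarith
  have hq₀ : ((γ.prod γ).prod (noise σ N)) Tᶜ ≤ ENNReal.ofReal (4 * ε) := by
    have hsub : Tᶜ ⊆ ⋃ k ∈ (Finset.univ : Finset (Fin 4)),
        zip ⁻¹' {x | N * lim k < ∑ i, f k (x i)} := by
      intro x hx
      simp only [T, Set.mem_compl_iff, Set.mem_ofPred_eq, not_forall, not_le] at hx
      obtain ⟨k, hk⟩ := hx
      exact Set.mem_iUnion₂.2 ⟨k, Finset.mem_univ k, hk⟩
    have hms : ∀ k, MeasurableSet {x : Fin N → (ℝ × ℝ) × ℝ | N * lim k < ∑ i, f k (x i)} :=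
      fun k => measurableSet_lt measurable_const
        (Finset.measurable_sum _ fun i _ => (mf k).comp (measurable_pi_apply i))
    refine (measure_mono hsub).trans ((measure_biUnion_finset_le _ _).trans ?_)
    refine (Finset.sum_le_card_nsmul _ _ (ENNReal.ofReal ε) fun k _ => ?_).trans ?_
    · rw [hzip.measure_preimage (hms k).nullMeasurableSet]
      exact hLLN k
    · rw [ENNReal.ofReal_mul (by norm_num)]
      simp
  have hwrong₂ : ∀ (u : Fin N → ℝ) (z : Fin N → ℝ),
      ∫⁻ v, ENNReal.ofReal (Real.exp (∑ i, i₂ (zip ((u, v), z) i))) ∂γ = 1 := fun u z =>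
    lintegral_exp_sum_infoDensity b hv fun i => z i - a * u i
  obtain ⟨u, v, dec, hdec, hbound⟩ := exists_superposition_code γ γ (noise σ N) hF hD₂ hD₁₂ hT
    hTD₂ hTD₁₂ hq₀ (q₂ := ENNReal.ofReal (Real.exp (-(N * t₂))))
    (q₁₂ := ENNReal.ofReal (Real.exp (-(N * t₁₂))))
    (fun u z => measure_le_exp_neg (f := fun v => ∑ i, i₂ (zip ((u, v), z) i))
      (ms₂.comp (by fun_prop : Measurable fun v : Fin N → ℝ => ((u, v), z))) (hwrong₂ u z).le _)
    (fun z => by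
      have hmz : Measurable fun p : (Fin N → ℝ) × (Fin N → ℝ) => (p, z) := by fun_prop
      have hm1 : Measurable fun p : (Fin N → ℝ) × (Fin N → ℝ) =>
        ∑ i, i₂ (zip (p, z) i) + ∑ i, i₁ (zip (p, z) i) := (ms₂.add ms₁).comp hmz
      refine measure_le_exp_neg (f := fun p => ∑ i, i₂ (zip (p, z) i) + ∑ i, i₁ (zip (p, z) i))
        hm1 (le_of_eq ?_) _
      have hme : Measurable fun p : (Fin N → ℝ) × (Fin N → ℝ) => ENNReal.ofReal
          (Real.exp (∑ i, i₂ (zip (p, z) i) + ∑ i, i₁ (zip (p, z) i))) :=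
        (Real.measurable_exp.comp hm1).ennreal_ofReal
      rw [lintegral_prod _ hme.aemeasurable]
      simp_rw [Real.exp_add, ENNReal.ofReal_mul (Real.exp_pos _).le]
      -- the density of the centre does not involve the satellite
      have h1 : ∀ u : Fin N → ℝ, ∫⁻ v, ENNReal.ofReal (Real.exp (∑ i, i₂ (zip ((u, v), z) i))) *
          ENNReal.ofReal (Real.exp (∑ i, i₁ (zip ((u, v), z) i))) ∂γ =
          ENNReal.ofReal (Real.exp (∑ i, infoDensity a (σ ^ 2 + b ^ 2) (z i) (u i))) := by
        intro u
        have hmv : Measurable fun v : Fin N → ℝ =>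
            ENNReal.ofReal (Real.exp (∑ i, i₂ (zip ((u, v), z) i))) :=
          (Real.measurable_exp.comp (ms₂.comp
            (by fun_prop : Measurable fun v : Fin N → ℝ => ((u, v), z)))).ennreal_ofReal
        have h := lintegral_mul_const (μ := γ)
          (ENNReal.ofReal (Real.exp (∑ i, infoDensity a (σ ^ 2 + b ^ 2) (z i) (u i)))) hmv
        rw [hwrong₂, one_mul] at h
        exact h
      simp_rw [h1]
      exact lintegral_exp_sum_infoDensity a hvb z)
    hM₁ hM₂
  let c : Code N M₁ M₂ :=
    { enc₁ := fun w₁ i => if ∑ i, (a₁ * u w₁ i) ^ 2 ≤ N * P₁ then a₁ * u w₁ i else 0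
      enc₂ := fun w₁ w₂ i => if ∑ i, (a₂ * u w₁ i + b * v w₁ w₂ i) ^ 2 ≤ N * P₂ then
        a₂ * u w₁ i + b * v w₁ w₂ i else 0
      dec := dec
      measurable_dec := hdec }
  refine ⟨c, ?_, ?_, ?_⟩
  · refine power_le_of_sum_sq_le (μ := noise σ N) (x := fun w₁ _ i => c.enc₁ w₁ i) fun w₁ w₂ => ?_
    by_cases h : ∑ i, (a₁ * u w₁ i) ^ 2 ≤ N * P₁
    · simpa only [c, if_pos h] using h
    · simp only [c, if_neg h]
      simpa using by positivity
  · refine power_le_of_sum_sq_le (μ := noise σ N) (x := fun w₁ w₂ i => c.enc₂ w₁ w₂ i)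
      fun w₁ w₂ => ?_
    by_cases h : ∑ i, (a₂ * u w₁ i + b * v w₁ w₂ i) ^ 2 ≤ N * P₂
    · simpa only [c, if_pos h] using h
    · simp only [c, if_neg h]
      simpa using by positivity
  · have hsub : ∀ w₁ w₂, {η | c.toFeedbackCode.dec (c.toFeedbackCode.output w₁ w₂ η) ≠ (w₁, w₂)} ⊆
        {e | dec (F (u w₁, v w₁ w₂) e) ≠ (w₁, w₂) ∨ ((u w₁, v w₁ w₂), e) ∉ T} := by
      intro w₁ w₂ η hη
      by_contra hcon
      simp only [Set.mem_ofPred_eq, not_or, not_not] at hcon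
      obtain ⟨hd, ht⟩ := hcon
      refine hη ?_
      have hp₁ : ∑ i, (a₁ * u w₁ i) ^ 2 ≤ N * P₁ := ht 0
      have hp₂ : ∑ i, (a₂ * u w₁ i + b * v w₁ w₂ i) ^ 2 ≤ N * P₂ := ht 1
      rw [Code.output_toFeedbackCode]
      have : (fun i => c.enc₁ w₁ i + c.enc₂ w₁ w₂ i + η i) = F (u w₁, v w₁ w₂) η := by
        funext i
        simp only [c, if_pos hp₁, if_pos hp₂, F, ha]
        ring
      rw [this]
      exact hd
    have hsum : ∑ w₁, ∑ w₂, noise σ N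
        {η | c.toFeedbackCode.dec (c.toFeedbackCode.output w₁ w₂ η) ≠ (w₁, w₂)} ≤
        ENNReal.ofReal (M₁ * M₂ * (6 * ε)) := by
      refine (Finset.sum_le_sum fun w₁ _ => Finset.sum_le_sum fun w₂ _ =>
        measure_mono (hsub w₁ w₂)).trans (hbound.trans ?_)
      rw [← ENNReal.ofReal_natCast M₁, ← ENNReal.ofReal_natCast M₂,
        ← ENNReal.ofReal_natCast (M₁ - 1), ← ENNReal.ofReal_natCast (M₂ - 1),
        ← ENNReal.ofReal_mul (by positivity), ← ENNReal.ofReal_mul (by positivity),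
        ← ENNReal.ofReal_mul (by positivity), ← ENNReal.ofReal_add (by positivity) (by positivity),
        ← ENNReal.ofReal_add (by positivity) (by positivity), ← ENNReal.ofReal_mul (by positivity),
        ← ENNReal.ofReal_mul (by positivity), mul_assoc]
      refine ENNReal.ofReal_le_ofReal ?_
      gcongr
      linarith
    rw [FeedbackCode.errorProb, div_le_iff₀ (by positivity)]
    have hreal : ∑ w₁, ∑ w₂, (noise σ N).real
        {η | c.toFeedbackCode.dec (c.toFeedbackCode.output w₁ w₂ η) ≠ (w₁, w₂)} =
        (∑ w₁, ∑ w₂, noise σ N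
          {η | c.toFeedbackCode.dec (c.toFeedbackCode.output w₁ w₂ η) ≠ (w₁, w₂)}).toReal := by
      rw [ENNReal.toReal_sum fun w₁ _ => ENNReal.sum_ne_top.2 fun w₂ _ => measure_ne_top _ _]
      refine Finset.sum_congr rfl fun w₁ _ => ?_
      rw [ENNReal.toReal_sum fun w₂ _ => measure_ne_top _ _]
      rfl
    rw [hreal, mul_comm (6 * ε)]
    exact ENNReal.toReal_le_of_le_ofReal (by positivity) hsum

/-! ### Achievability -/

/-- The integer part of `2 ^ (N r)`: the number of messages of rate `r` bits per channel use. It is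
`1` for `r = 0`, so that no wrong message exists at rate zero. -/
noncomputable def numMessages (N : ℕ) (r : ℝ) : ℕ := ⌊Real.exp (N * (r * Real.log 2))⌋₊

lemma numMessages_pos (N : ℕ) {r : ℝ} (hr : 0 ≤ r) : 0 < numMessages N r := by
  have hlog2 : 0 < Real.log 2 := Real.log_pos one_lt_two
  exact Nat.floor_pos.2 (Real.one_le_exp (by positivity))

lemma numMessages_le (N : ℕ) (r : ℝ) : (numMessages N r : ℝ) ≤ Real.exp (N * (r * Real.log 2)) :=
  Nat.floor_le (Real.exp_pos _).le

lemma numMessages_zero (N : ℕ) : numMessages N 0 = 1 := by simp [numMessages]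

lemma abs_rate_sub_le {N : ℕ} (hN : 0 < N) {r : ℝ} (hr : 0 ≤ r) :
    |Real.logb 2 (numMessages N r) / N - r| ≤ 1 / N := by
  have hlog2 : 0 < Real.log 2 := Real.log_pos one_lt_two
  have hNpos : (0 : ℝ) < N := by exact_mod_cast hN
  have hM : (1 : ℝ) ≤ numMessages N r := by exact_mod_cast numMessages_pos N hr
  have hup : Real.log (numMessages N r) ≤ N * (r * Real.log 2) :=
    (Real.log_le_iff_le_exp (by linarith)).2 (numMessages_le N r)
  have hlow : N * (r * Real.log 2) ≤ Real.log (numMessages N r) + Real.log 2 := by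
    rw [← Real.log_mul (by linarith) two_ne_zero, Real.le_log_iff_exp_le (by linarith)]
    have : Real.exp (N * (r * Real.log 2)) < numMessages N r + 1 := Nat.lt_floor_add_one _
    linarith
  have key : Real.logb 2 (numMessages N r) / N - r =
      (Real.log (numMessages N r) - N * (r * Real.log 2)) / (N * Real.log 2) := by
    rw [Real.logb]
    field_simp
  have hone : (1 : ℝ) / N = Real.log 2 / (N * Real.log 2) := by field_simp
  rw [key, abs_div, abs_of_pos (by positivity : (0 : ℝ) < N * Real.log 2), hone]
  gcongr
  rw [abs_le]
  constructor <;> linarith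

open Filter Topology in
/-- Lowering the power slightly lowers the mutual information only slightly. -/
lemma eventually_lt_half_log {X σ t : ℝ} (hX : 0 ≤ X) (hσ : 0 < σ)
    (ht : t < 1 / 2 * Real.log (1 + X / σ ^ 2)) :
    ∀ᶠ κ in 𝓝[>] (0 : ℝ), t < 1 / 2 * Real.log (1 + (1 - κ) * X / σ ^ 2) := by
  have hc : ContinuousAt (fun κ : ℝ => 1 / 2 * Real.log (1 + (1 - κ) * X / σ ^ 2)) 0 := by
    refine ContinuousAt.mul continuousAt_const (ContinuousAt.log (by fun_prop) ?_)
    simp only [sub_zero, one_mul]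
    positivity
  have h0 : t < (fun κ : ℝ => 1 / 2 * Real.log (1 + (1 - κ) * X / σ ^ 2)) 0 := by simpa using ht
  exact (hc.eventually (lt_mem_nhds h0)).filter_mono nhdsWithin_le_nhds

open Filter Topology in
/-- Achievability: the explicit region is reached without feedback. -/
lemma explicitRegion_subset {P₁ P₂ σ : ℝ} (hP₁ : 0 ≤ P₁) (hP₂ : 0 ≤ P₂) (hσ : 0 < σ) :
    explicitRegion P₁ P₂ σ ⊆ capacityRegion P₁ P₂ σ := by
  rintro R hR ε hε
  obtain ⟨ρ, ⟨hρ0, hρ1⟩, hR₁, hR₂, hb₂, hb₁₂⟩ := Set.mem_iUnion₂.1 hR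
  have hlog2 : 0 < Real.log 2 := Real.log_pos one_lt_two
  set δ := ε / 2 with hδ
  have hδ0 : 0 < δ := by positivity
  set X₂ := P₂ * (1 - ρ ^ 2) with hX₂
  set X₁₂ := P₁ + P₂ + 2 * √(P₁ * P₂) * ρ with hX₁₂
  have hρ2 : 0 ≤ 1 - ρ ^ 2 := by nlinarith
  have hX₂0 : 0 ≤ X₂ := mul_nonneg hP₂ hρ2
  have hX₁₂0 : 0 ≤ X₁₂ := by positivity
  set t₂ := (R.2 - δ / 2) * Real.log 2 with ht₂
  set t₁₂ := (R.1 + R.2 - δ / 2) * Real.log 2 with ht₁₂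
  have hnat : ∀ x y : ℝ, x ≤ 1 / 2 * Real.logb 2 y →
      (x - δ / 2) * Real.log 2 < 1 / 2 * Real.log y := by
    intro x y h
    rw [Real.logb, ← mul_div_assoc, le_div_iff₀ hlog2] at h
    nlinarith
  have hlt₂ := eventually_lt_half_log hX₂0 hσ (hnat _ _ hb₂)
  have hlt₁₂ := eventually_lt_half_log hX₁₂0 hσ (hnat _ _ hb₁₂)
  have hκ1 : ∀ᶠ κ in 𝓝[>] (0 : ℝ), κ < 1 := nhdsWithin_le_nhds (gt_mem_nhds one_pos)
  obtain ⟨κ, hκ₂, hκ₁₂, hκ1, hκ0⟩ :=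
    (hlt₂.and (hlt₁₂.and (hκ1.and self_mem_nhdsWithin))).exists
  have hκ0 : 0 < κ := hκ0
  have hκ : 0 ≤ 1 - κ := by linarith
  -- the amplitudes of a code with powers `(1 - κ) P₁`, `(1 - κ) P₂` and correlation `ρ`
  set a₁ := √((1 - κ) * P₁) with ha₁
  set a₂ := ρ * √((1 - κ) * P₂) with ha₂
  set b := √((1 - ρ ^ 2) * ((1 - κ) * P₂)) with hb
  have ea₁ : a₁ ^ 2 = (1 - κ) * P₁ := Real.sq_sqrt (by positivity)
  have ea₂ : a₂ ^ 2 = ρ ^ 2 * ((1 - κ) * P₂) := by rw [ha₂, mul_pow, Real.sq_sqrt (by positivity)]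
  have eb : b ^ 2 = (1 - ρ ^ 2) * ((1 - κ) * P₂) := Real.sq_sqrt (by positivity)
  have eab : a₁ * a₂ = (1 - κ) * (√(P₁ * P₂) * ρ) := by
    rw [ha₁, ha₂, Real.sqrt_mul hκ, Real.sqrt_mul hκ, Real.sqrt_mul hP₁]
    linear_combination (ρ * √P₁ * √P₂) * Real.mul_self_sqrt hκ
  have h₁ : a₁ ^ 2 < P₁ ∨ a₁ = 0 := by
    rcases eq_or_lt_of_le hP₁ with h | h
    · right; rw [ha₁, ← h]; simp
    · left; rw [ea₁]; nlinarith
  have h₂ : a₂ ^ 2 + b ^ 2 < P₂ ∨ a₂ = 0 ∧ b = 0 := by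
    rcases eq_or_lt_of_le hP₂ with h | h
    · right; rw [ha₂, hb, ← h]; simp
    · left; rw [ea₂, eb]; nlinarith
  have ht₂' : t₂ < 1 / 2 * Real.log (1 + b ^ 2 / σ ^ 2) := by
    rw [eb, show (1 - ρ ^ 2) * ((1 - κ) * P₂) = (1 - κ) * X₂ by rw [hX₂]; ring]
    exact hκ₂
  have ht₁₂' : t₁₂ < 1 / 2 * Real.log (1 + ((a₁ + a₂) ^ 2 + b ^ 2) / σ ^ 2) := by
    have : (a₁ + a₂) ^ 2 + b ^ 2 = (1 - κ) * X₁₂ := by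
      rw [hX₁₂]
      linear_combination ea₁ + ea₂ + eb + 2 * eab
    rw [this]
    exact hκ₁₂
  obtain ⟨N₀, hcode⟩ := exists_code hσ hP₁ hP₂ h₁ h₂ ht₂' ht₁₂' (ε := ε / 6) (by positivity)
  -- the rates are backed off by `δ`, while the thresholds are backed off by `δ / 2` only
  have hexp : Tendsto (fun N : ℕ => Real.exp (-(N * (δ / 2 * Real.log 2)))) atTop (𝓝 0) :=
    Real.tendsto_exp_neg_atTop_nhds_zero.comp
      (tendsto_natCast_atTop_atTop.atTop_mul_const (by positivity))
  obtain ⟨N₁, hN₁⟩ := eventually_atTop.1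
    (hexp.eventually (gt_mem_nhds (by positivity : (0 : ℝ) < ε / 6)))
  obtain ⟨N₂, hN₂⟩ := exists_nat_gt (1 / δ)
  refine ⟨N₀ + N₁ + (N₂ + 1), fun N hN => ?_⟩
  have hNpos : 0 < N := by omega
  have hNR : (0 : ℝ) < N := by exact_mod_cast hNpos
  have hinv : 1 / (N : ℝ) ≤ δ := by
    have : (N₂ : ℝ) ≤ N := by exact_mod_cast (by omega : N₂ ≤ N)
    rw [div_le_iff₀ hNR]
    rw [div_lt_iff₀ hδ0] at hN₂
    nlinarith
  have hsmall : Real.exp (-(N * (δ / 2 * Real.log 2))) ≤ ε / 6 := (hN₁ N (by omega)).le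
  set r₁ := max (R.1 - δ) 0 with hr₁
  set r₂ := max (R.2 - δ) 0 with hr₂
  have hr₁0 : 0 ≤ r₁ := le_max_right _ _
  have hr₂0 : 0 ≤ r₂ := le_max_right _ _
  have hr₂R : r₂ ≤ R.2 := max_le (by linarith) hR₂
  have hrate : ∀ x r : ℝ, 0 ≤ x → r = max (x - δ) 0 →
      |Real.logb 2 (numMessages N r) / N - x| ≤ ε := by
    intro x r hx hr
    have h0 : 0 ≤ r := hr ▸ le_max_right _ _
    have h1 : x - δ ≤ r := hr ▸ le_max_left _ _
    have h2 : r ≤ x := hr ▸ max_le (by linarith) hx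
    have := abs_le.1 ((abs_rate_sub_le hNpos h0).trans hinv)
    rw [abs_le]
    constructor <;> linarith [this.1, this.2]
  have hcast : ∀ M : ℕ, ((M - 1 : ℕ) : ℝ) ≤ M := fun M => by exact_mod_cast Nat.sub_le M 1
  obtain ⟨c, hp₁, hp₂, herr⟩ := hcode N (by omega) (numMessages N r₁) (numMessages N r₂)
    (numMessages_pos N hr₁0) (numMessages_pos N hr₂0) (by
      rcases le_total (R.2 - δ) 0 with h | h
      · have : r₂ = 0 := max_eq_right h
        rw [this, numMessages_zero]
        simpa using by positivity
      · have hr : r₂ = R.2 - δ := max_eq_left h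
        calc ((numMessages N r₂ - 1 : ℕ) : ℝ) * Real.exp (-(N * t₂))
            ≤ Real.exp (N * (r₂ * Real.log 2)) * Real.exp (-(N * t₂)) := by
              gcongr
              exact (hcast _).trans (numMessages_le _ _)
          _ = Real.exp (-(N * (δ / 2 * Real.log 2))) := by
              rw [← Real.exp_add, ht₂, hr]
              congr 1
              ring
          _ ≤ ε / 6 := hsmall) (by
      rcases le_total (R.1 - δ) 0 with h | h
      · have : r₁ = 0 := max_eq_right h
        rw [this, numMessages_zero]
        simpa using by positivity
      · have hr : r₁ = R.1 - δ := max_eq_left h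
        calc ((numMessages N r₁ - 1 : ℕ) : ℝ) * (numMessages N r₂ * Real.exp (-(N * t₁₂)))
            ≤ Real.exp (N * (r₁ * Real.log 2)) *
              (Real.exp (N * (R.2 * Real.log 2)) * Real.exp (-(N * t₁₂))) := by
              gcongr
              · exact (hcast _).trans (numMessages_le _ _)
              · refine (numMessages_le _ _).trans ?_
                gcongr
          _ = Real.exp (-(N * (δ / 2 * Real.log 2))) := by
              rw [← Real.exp_add, ← Real.exp_add, ht₁₂, hr]
              congr 1
              ring
          _ ≤ ε / 6 := hsmall)
  exact ⟨_, _, numMessages_pos N hr₁0, numMessages_pos N hr₂0, c, hp₁, hp₂, hrate _ _ hR₁ hr₁,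
    hrate _ _ hR₂ hr₂, herr.trans (by linarith)⟩

lemma capacityRegion_subset_feedbackCapacityRegion (P₁ P₂ σ : ℝ) :
    capacityRegion P₁ P₂ σ ⊆ feedbackCapacityRegion P₁ P₂ σ := by
  intro R hR ε hε
  obtain ⟨N₀, h⟩ := hR ε hε
  refine ⟨N₀, fun N hN => ?_⟩
  obtain ⟨M₁, M₂, h₁, h₂, c, hc⟩ := h N hN
  exact ⟨M₁, M₂, h₁, h₂, c.toFeedbackCode, hc⟩

end GMACDMS

theorem theorem5 (P₁ P₂ σ : ℝ) (hP₁ : 0 ≤ P₁) (hP₂ : 0 ≤ P₂) (hσ : 0 < σ) :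
    GMACDMS.feedbackCapacityRegion P₁ P₂ σ = GMACDMS.capacityRegion P₁ P₂ σ ∧
      GMACDMS.capacityRegion P₁ P₂ σ = GMACDMS.explicitRegion P₁ P₂ σ := by
  have h₁ := GMACDMS.capacityRegion_subset_feedbackCapacityRegion P₁ P₂ σ
  have h₂ := GMACDMS.feedbackCapacityRegion_subset hP₁ hP₂ hσ
  have h₃ := GMACDMS.explicitRegion_subset hP₁ hP₂ hσ
  exact ⟨(h₂.trans h₃).antisymm h₁, (h₁.trans h₂).antisymm h₃⟩
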